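/- An element $a$ of a semigroup $S$ is called \emph{regular} if $a=axa$ for some $x\in S$, and $S$ is called \emph{regularly closed} if the product of any two regular elements of $S$ is regular. A \emph{semigroup identity} is a formal equality $u=v$ of two nonempty words over the countable alphabet of letters $0,1,2,\dots$; it holds in $S$ if $u$ and $v$ take the same value under every substitution of elements of $S$ for the letters. The \emph{variety} defined by a set of identities consists of all semigroups in which all these identities hold. There is a linear-time algorithm that, given a finite list $E=(u_1=v_1,\dots,u_k=v_k)$, $k\ge 0$, of semigroup identities, decides whether all semigroups in the variety defined by $E$ are regularly closed. Precisely: let $N=\sum_{i}(|u_i|+|v_i|)$ be the total number of occurrences of letters in $E$, and let $M$ be the largest letter occurring in $E$ ($M=0$ if $E$ is empty). The input is the sequence of numbers in which $u_1,v_1,\dots,u_k,v_k$ are written one after the other, with one number $x+1$ for each occurrence of a letter $x$ and one number $0$ after each word. Then there are a constant $C$ and a program for a unit-cost random access machine (finitely many registers and random access arrays of nonnegative integers; the input sequence is in one array, its length is in one register, and all the rest of the memory is initially zero; each loading of a constant, copying, addition, truncated subtraction, indirect load, indirect store and comparison of registers is one step) which, for every $E$, halts after at most $C\cdot(N+1)$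 steps, writes during its run only numbers that are at most $C\cdot(N+M+1)$, and answers $1$ if all semigroups in the variety defined by $E$ are regularly closed, and $0$ otherwise. -/

import Mathlib

universe u

/-! ### Semigroups, identities, varieties -/

/-- An element `a` of a semigroup is regular (in von Neumann's sense) if `a = a x a` for some `x`. -/
def IsRegularElement {S : Type u} [Semigroup S] (a : S) : Prop :=
  ∃ x : S, a = a * x * a

/-- A semigroup is regularly closed if the product of any two regular elements is regular. -/
def RegularlyClosed (S : Type u) [Semigroup S] : Prop :=
  ∀ a b : S, IsRegularElement a → IsRegularElement b → IsRegularElement (a * b)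

/-- A semigroup identity `lhs = rhs` between two (nonempty) words over the countable alphabet of
letters `0, 1, 2, …`. -/
structure Identity where
  lhs : FreeSemigroup ℕ
  rhs : FreeSemigroup ℕ

/-- The semigroup `S` satisfies the identity: both sides take the same value under every
substitution of elements of `S` for the letters. -/
def Identity.HoldsIn (e : Identity) (S : Type u) [Semigroup S] : Prop :=
  ∀ f : ℕ → S, FreeSemigroup.lift f e.lhs = FreeSemigroup.lift f e.rhs

/-- `S` belongs to the variety of semigroups defined by the finite list `E` of identities. -/
def InVariety (E : List Identity) (S : Type u) [Semigroup S] : Prop :=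
  ∀ e ∈ E, e.HoldsIn S

/-- All semigroups of the variety defined by `E` are regularly closed. -/
def VarietyRegularlyClosed (E : List Identity) : Prop :=
  ∀ (S : Type u) [Semigroup S], InVariety E S → RegularlyClosed S

/-! ### A random access machine with unit cost and bounded words -/

namespace RAM

/-- Memory: number registers, and random access arrays of numbers. A given program is a finite
text, and uses only a fixed finite number of registers and of arrays. -/
structure Store where
  reg : ℕ → ℕ
  arr : ℕ → ℕ → ℕ

/-- Write a value into a register. -/
def Store.setReg (s : Store) (r v : ℕ) : Store :=
  { s with reg := Function.update s.reg r v }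

/-- Write a value into the cell with address `i` of the array `a`. -/
def Store.setArr (s : Store) (a i v : ℕ) : Store :=
  { s with arr := Function.update s.arr a (Function.update (s.arr a) i v) }

/-- Comparisons of two registers. -/
inductive Test where
  | eq (r q : ℕ)
  | lt (r q : ℕ)

/-- The outcome of a comparison. -/
def Test.Holds (s : Store) : Test → Prop
  | .eq r q => s.reg r = s.reg q
  | .lt r q => s.reg r < s.reg q

/-- Programs. -/
inductive Program where
  /-- no operation -/
  | skip
  /-- `reg r := n` -/
  | const (r n : ℕ)
  /-- `reg r := reg p` -/
  | copy (r p : ℕ)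
  /-- `reg r := reg p + reg q` -/
  | add (r p q : ℕ)
  /-- `reg r := max (reg p - reg q) 0` -/
  | sub (r p q : ℕ)
  /-- `reg r := arr a [reg p]` -/
  | load (r a p : ℕ)
  /-- `arr a [reg p] := reg q` -/
  | store (a p q : ℕ)
  | seq (c d : Program)
  | ite (b : Test) (c d : Program)
  | loop (b : Test) (c : Program)

/-- `Exec W c s t s'`: on a machine whose words hold the numbers `0, …, W`, the program `c` started
in `s` halts in `s'` after exactly `t` steps. Every elementary instruction and every test is one
step. An instruction that would write a number larger than `W` cannot be executed (the machine is
stuck, and does not halt). -/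
inductive Exec (W : ℕ) : Program → Store → ℕ → Store → Prop
  | skip (s : Store) : Exec W .skip s 1 s
  | const (s : Store) (r n : ℕ) (h : n ≤ W) :
      Exec W (.const r n) s 1 (s.setReg r n)
  | copy (s : Store) (r p : ℕ) (h : s.reg p ≤ W) :
      Exec W (.copy r p) s 1 (s.setReg r (s.reg p))
  | add (s : Store) (r p q : ℕ) (h : s.reg p + s.reg q ≤ W) :
      Exec W (.add r p q) s 1 (s.setReg r (s.reg p + s.reg q))
  | sub (s : Store) (r p q : ℕ) (h : s.reg p - s.reg q ≤ W) :
      Exec W (.sub r p q) s 1 (s.setReg r (s.reg p - s.reg q))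
  | load (s : Store) (r a p : ℕ) (h : s.arr a (s.reg p) ≤ W) :
      Exec W (.load r a p) s 1 (s.setReg r (s.arr a (s.reg p)))
  | store (s : Store) (a p q : ℕ) (h : s.reg q ≤ W) :
      Exec W (.store a p q) s 1 (s.setArr a (s.reg p) (s.reg q))
  | seq {c d : Program} {s s' s'' : Store} {t t' : ℕ}
      (hc : Exec W c s t s') (hd : Exec W d s' t' s'') :
      Exec W (.seq c d) s (t + t') s''
  | iteTrue {b : Test} {c d : Program} {s s' : Store} {t : ℕ}
      (hb : b.Holds s) (hc : Exec W c s t s') :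
      Exec W (.ite b c d) s (1 + t) s'
  | iteFalse {b : Test} {c d : Program} {s s' : Store} {t : ℕ}
      (hb : ¬ b.Holds s) (hd : Exec W d s t s') :
      Exec W (.ite b c d) s (1 + t) s'
  | loopTrue {b : Test} {c : Program} {s s' s'' : Store} {t t' : ℕ}
      (hb : b.Holds s) (hc : Exec W c s t s') (hl : Exec W (.loop b c) s' t' s'') :
      Exec W (.loop b c) s (1 + t + t') s''
  | loopFalse {b : Test} {c : Program} {s : Store} (hb : ¬ b.Holds s) :
      Exec W (.loop b c) s 1 s

/-- The machine is deterministic: a halting run has a unique result and a unique running time. -/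
theorem Exec.deterministic {W : ℕ} {c : Program} {s s₁ s₂ : Store} {t₁ t₂ : ℕ}
    (h₁ : Exec W c s t₁ s₁) (h₂ : Exec W c s t₂ s₂) : t₁ = t₂ ∧ s₁ = s₂ := by
  induction h₁ generalizing t₂ s₂ with
  | skip | const | copy | add | sub | load | store => cases h₂; exact ⟨rfl, rfl⟩
  | seq _ _ ih ih' =>
    cases h₂ with
    | seq a b =>
      obtain ⟨rfl, rfl⟩ := ih a
      obtain ⟨rfl, rfl⟩ := ih' b
      exact ⟨rfl, rfl⟩
  | iteTrue hb _ ih =>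
    cases h₂ with
    | iteTrue _ a => obtain ⟨rfl, rfl⟩ := ih a; exact ⟨rfl, rfl⟩
    | iteFalse hb' _ => exact absurd hb hb'
  | iteFalse hb _ ih =>
    cases h₂ with
    | iteTrue hb' _ => exact absurd hb' hb
    | iteFalse _ a => obtain ⟨rfl, rfl⟩ := ih a; exact ⟨rfl, rfl⟩
  | loopTrue hb _ _ ih ih' =>
    cases h₂ with
    | loopTrue _ a b =>
      obtain ⟨rfl, rfl⟩ := ih a
      obtain ⟨rfl, rfl⟩ := ih' b
      exact ⟨rfl, rfl⟩
    | loopFalse hb' => exact absurd hb hb'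
  | loopFalse hb =>
    cases h₂ with
    | loopTrue hb' _ _ => exact absurd hb' hb
    | loopFalse _ => exact ⟨rfl, rfl⟩

/-- The initial memory on the input `l`: the entries of `l` are in the array `0`, the length of `l`
is in the register `0`, and everything else is `0`. -/
def initStore (l : List ℕ) : Store where
  reg := fun r => if r = 0 then l.length else 0
  arr := fun a i => if a = 0 then l.getD i 0 else 0

end RAM

/-! ### Lists of identities as input -/

/-- The letters of a word, in order. -/
def letters (w : FreeSemigroup ℕ) : List ℕ :=
  w.head :: w.tail

/-- A word is written down letter by letter, one number `x + 1` for each occurrence of the letter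
`x`, and closed by the separator `0`. -/
def encodeWord (w : FreeSemigroup ℕ) : List ℕ :=
  (letters w).map (· + 1) ++ [0]

/-- The identities are written down one after the other, the left side before the right side. -/
def encodeIdentities (E : List Identity) : List ℕ :=
  E.flatMap fun e => encodeWord e.lhs ++ encodeWord e.rhs

/-- The size of the input: the total number of occurrences of letters in the identities. -/
def totalLength (E : List Identity) : ℕ :=
  (E.map fun e => (letters e.lhs).length + (letters e.rhs).length).sum

/-- The largest letter that occurs in the identities (`0` if there are none). -/
def maxLetter (E : List Identity) : ℕ :=
  (E.flatMap fun e => letters e.lhs ++ letters e.rhs).foldr max 0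

/-- A property of finite lists of identities is decidable in linear time: some program, on every
input `E`, halts after at most `k * (totalLength E + 1)` steps with `1` in the register `0` if `E`
has the property and with `0` if not, where the words of the machine need only hold numbers that are
at most linear in the size of the input and the numbers that name the letters. -/
def DecidableInLinearTime (P : List Identity → Prop) : Prop :=
  ∃ (p : RAM.Program) (k : ℕ), ∀ E : List Identity, ∃ (t : ℕ) (s : RAM.Store),
    RAM.Exec (k * (totalLength E + maxLetter E + 1)) p (RAM.initStore (encodeIdentities E)) t s ∧
    t ≤ k * (totalLength E + 1) ∧
    (P E → s.reg 0 = 1) ∧ (¬ P E → s.reg 0 = 0)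

/-! ### The four-element semigroup that is not regularly closed -/

/-! All semigroups of a variety are regularly closed exactly when the variety omits `IdemPair`, in
which e * f is not regular. For the nontrivial direction, let an identity hold in S but fail in
`IdemPair`, and let e, f be idempotents of S. With f * e in place of zero, the failing substitution
becomes one into S; its two values are equal in S, but are products of e's and f's that represent
different elements of `IdemPair`. Multiplied by e on the left and by f on the right, a product
representing a nonzero element becomes e * f, and one representing zero becomes (e * f) ^ k with k ≥
2. So e * f is regular, unless both elements are nonzero; then e * f equals e or f and is
idempotent. Regular closedness follows from products of idempotents. This is
`varietyRegularlyClosed_iff`.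

It remains to decide which identities hold in `IdemPair`. A product there is nonzero iff its factors
are nonzero and any two of them, taken in order, have a nonzero product; moreover, "a * b is
nonzero" is a transitive relation. Hence a word matters only through its set of letters and the
transitive closure of "some occurrence of x precedes some occurrence of y". The finest cutting of
the word into segments with disjoint contents describes this closure: one needs the segment number
of each letter and whether that segment has length one. This is the block code, and
`IdemPair.holdsIn_iff` says that equality of block codes is the criterion.

Once last occurrences are known, one greedy scan gives the code: a block stays open until the
furthest last occurrence of its letters. Tables indexed by letters are compared and cleared by
rereading the two words, so the cost does not depend on the size of the letters. -/

/-- The semigroup with zero generated by two idempotents `e`, `f` subject to `f * e = 0`. -/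
inductive IdemPair : Type u
  | e | f | ef | zero

namespace IdemPair

/-- The multiplication table. -/
def mul : IdemPair.{u} → IdemPair.{u} → IdemPair.{u}
  | e, e => e
  | e, f => ef
  | e, ef => ef
  | f, f => f
  | ef, f => ef
  | _, _ => zero

instance : Semigroup IdemPair.{u} where
  mul := mul
  mul_assoc a b c := by cases a <;> cases b <;> cases c <;> rfl

theorem not_regularlyClosed : ¬ RegularlyClosed IdemPair.{u} := by
  intro h
  obtain ⟨x, hx⟩ := h e f ⟨e, rfl⟩ ⟨f, rfl⟩
  cases x <;> cases hx

/-- A product of nonzero elements vanishes only if a factor involving f comes somewhere before one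
involving e, which is a condition on pairs of factors. -/
theorem mul_mul_ne_zero (a b c : IdemPair.{u}) :
    a * (b * c) ≠ zero ↔ a * b ≠ zero ∧ a * c ≠ zero ∧ b * c ≠ zero := by
  cases a <;> cases b <;> cases c <;> simp [HMul.hMul, Mul.mul, mul]

theorem left_ne_zero {a b : IdemPair.{u}} (h : a * b ≠ zero) : a ≠ zero := by
  rintro rfl
  exact h rfl

/-- If a involves f and c involves e, then b could involve neither e nor f. This is why only the
transitive closure of the precedence of letters matters. -/
theorem mul_ne_zero_trans {a b c : IdemPair.{u}} (h : a * b ≠ zero) (h' : b * c ≠ zero) :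
    a * c ≠ zero := by
  revert h h'
  cases a <;> cases b <;> cases c <;> simp [HMul.hMul, Mul.mul, mul]

end IdemPair

/-! ### Products of idempotents -/

/-- If a = axa and b = byb, then xa and by are idempotents with a(xa·by)b = ab, so a witness z for
xa·by yields the witness yzx for ab. -/
theorem regularlyClosed_of_isRegularElement_mul {S : Type u} [Semigroup S]
    (h : ∀ e f : S, e * e = e → f * f = f → IsRegularElement (e * f)) : RegularlyClosed S := by
  rintro a b ⟨x, hx⟩ ⟨y, hy⟩
  obtain ⟨z, hz⟩ := h (x * a) (b * y) (by rw [← mul_assoc, mul_assoc x, mul_assoc x, ← hx])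
    (by rw [← mul_assoc, ← hy])
  refine ⟨y * z * x, ?_⟩
  have h1 : a * (x * a * (b * y)) * b = a * b := by
    calc a * (x * a * (b * y)) * b = (a * x * a) * (b * y * b) := by simp only [mul_assoc]
      _ = a * b := by rw [← hx, ← hy]
  calc a * b = a * (x * a * (b * y)) * b := h1.symm
    _ = a * (x * a * (b * y) * z * (x * a * (b * y))) * b := by rw [← hz]
    _ = (a * x * a) * (b * y * z * x * a) * (b * y * b) := by simp only [mul_assoc]
    _ = a * b * (y * z * x) * (a * b) := by rw [← hx, ← hy]; simp only [mul_assoc]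

section Idempotents

variable {M : Type u} [Monoid M] {e f : M}

/-- Repeated letters are absorbed, so a word in e and f beginning with e and ending with f
alternates. The second half carries the induction through a leading f. -/
theorem exists_pow_of_mem_closure (he : e * e = e) (hf : f * f = f) {x : M}
    (hx : x ∈ Submonoid.closure {e, f}) :
    (∃ n : ℕ, e * x * f = (e * f) ^ (n + 1)) ∧ ∃ n : ℕ, f * x * f = f * (e * f) ^ n := by
  induction hx using Submonoid.closure_induction_left with
  | one => exact ⟨⟨0, by simp⟩, ⟨0, by simp [hf]⟩⟩
  | mul_left y hy x _ ih =>
    obtain ⟨⟨n, hn⟩, ⟨m, hm⟩⟩ := ih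
    rcases hy with rfl | rfl
    · refine ⟨⟨n, by rw [← mul_assoc y, he, hn]⟩, ⟨n + 1, ?_⟩⟩
      rw [← hn]; simp only [mul_assoc]
    · refine ⟨⟨m, ?_⟩, ⟨m, by rw [← mul_assoc y, hf, hm]⟩⟩
      rw [pow_succ', mul_assoc e y, ← hm]; simp only [mul_assoc]

/-- `s` is a product of `e`s and `f`s that evaluates to the given element of `IdemPair`. -/
def IdemPair.Represents (e f : M) (a : IdemPair.{u}) (s : M) : Prop :=
  s ∈ Submonoid.closure {e, f} ∧
  match a with
  | .e => s = e
  | .f => s = f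
  | .ef => s = e * f
  | .zero => ∃ x ∈ Submonoid.closure {e, f}, ∃ y ∈ Submonoid.closure {e, f}, s = x * (f * e) * y

/-- Representing zero only requires a factor f * e somewhere, which survives multiplication on
either side. -/
theorem IdemPair.Represents.mul (he : e * e = e) (hf : f * f = f) {a b : IdemPair.{u}} {s t : M}
    (hs : Represents e f a s) (ht : Represents e f b t) : Represents e f (a * b) (s * t) := by
  obtain ⟨hs, hs'⟩ := hs
  obtain ⟨ht, ht'⟩ := ht
  refine ⟨mul_mem hs ht, ?_⟩
  have hone := one_mem (Submonoid.closure {e, f})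
  have hE : e ∈ Submonoid.closure {e, f} := Submonoid.subset_closure (by simp)
  have hF : f ∈ Submonoid.closure {e, f} := Submonoid.subset_closure (by simp)
  have left (h : ∃ x ∈ Submonoid.closure {e, f}, ∃ y ∈ Submonoid.closure {e, f},
      s = x * (f * e) * y) : ∃ x ∈ Submonoid.closure {e, f}, ∃ y ∈ Submonoid.closure {e, f},
      s * t = x * (f * e) * y := by
    obtain ⟨x, hx, y, hy, rfl⟩ := h
    exact ⟨x, hx, y * t, mul_mem hy ht, by simp only [mul_assoc]⟩
  have right (h : ∃ x ∈ Submonoid.closure {e, f}, ∃ y ∈ Submonoid.closure {e, f},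
      t = x * (f * e) * y) : ∃ x ∈ Submonoid.closure {e, f}, ∃ y ∈ Submonoid.closure {e, f},
      s * t = x * (f * e) * y := by
    obtain ⟨x, hx, y, hy, rfl⟩ := h
    exact ⟨s * x, mul_mem hs hx, y, hy, by simp only [mul_assoc]⟩
  cases a <;> cases b
  all_goals first
    | exact left hs'
    | exact right ht'
    | skip
  all_goals
    dsimp only at hs' ht'
    subst hs' ht'
  · exact he
  · exact rfl
  · change s * (s * f) = s * f
    rw [← mul_assoc, he]
  · exact ⟨1, hone, 1, hone, by simp⟩
  · exact hf
  · exact ⟨1, hone, s, hF, by simp [mul_assoc]⟩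
  · exact ⟨t, hE, 1, hone, by simp [mul_assoc]⟩
  · change e * t * t = e * t
    rw [mul_assoc, hf]
  · exact ⟨e, hE, f, hF, by simp [mul_assoc]⟩

/-- Elements that represent different elements of `IdemPair` coincide only if `e * f` is regular. -/
theorem IdemPair.Represents.exists_eq (he : e * e = e) (hf : f * f = f) {a b : IdemPair.{u}}
    {s : M} (hs : Represents e f a s) (ht : Represents e f b s) (hab : a ≠ b) :
    ∃ x, e * f = e * f * x * (e * f) := by
  have nonzero {c : IdemPair.{u}} (h : Represents e f c s) (hc : c ≠ zero) :
      e * s * f = e * f := by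
    obtain ⟨-, h⟩ := h
    cases c <;> dsimp only at h
    · rw [h, he]
    · rw [h, mul_assoc, hf]
    · rw [h, ← mul_assoc, he, mul_assoc, hf]
    · exact absurd rfl hc
  -- The factor f * e splits the product into two powers of e * f, each with exponent at least one,
  -- so the total exponent is at least two.
  have isZero (h : Represents e f zero s) : ∃ n, e * s * f = e * f * (e * f) ^ n * (e * f) := by
    obtain ⟨-, x, hx, y, hy, rfl⟩ := h
    obtain ⟨⟨n, hn⟩, -⟩ := exists_pow_of_mem_closure he hf hx
    obtain ⟨⟨m, hm⟩, -⟩ := exists_pow_of_mem_closure he hf hy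
    refine ⟨n + m, ?_⟩
    calc e * (x * (f * e) * y) * f = (e * x * f) * (e * y * f) := by simp only [mul_assoc]
      _ = _ := by rw [hn, hm, ← pow_add, ← pow_succ', ← pow_succ]; congr 1; omega
  by_cases ha : a = zero
  · subst ha
    obtain ⟨n, hn⟩ := isZero hs
    exact ⟨_, (nonzero ht hab.symm).symm.trans hn⟩
  by_cases hb : b = zero
  · subst hb
    obtain ⟨n, hn⟩ := isZero ht
    exact ⟨_, (nonzero hs hab).symm.trans hn⟩
  obtain ⟨-, hs⟩ := hs
  obtain ⟨-, ht⟩ := ht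
  have key (h : e * f * (e * f) = e * f) : ∃ x, e * f = e * f * x * (e * f) :=
    ⟨1, by rw [mul_one, h]⟩
  -- Any coincidence among e, f and e * f makes e * f equal to e or f.
  have idem (h : e * f = e ∨ e * f = f) : ∃ x, e * f = e * f * x * (e * f) := by
    rcases h with h | h
    · exact key (by rw [h, he])
    · exact key (by rw [h, hf])
  cases a <;> cases b <;> dsimp only at hs ht <;> first
    | exact absurd rfl hab
    | exact absurd rfl ha
    | exact absurd rfl hb
    | skip
  · exact idem (.inl (by rw [← ht, hs, he]))
  · exact idem (.inl (by rw [← ht, hs]))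
  · exact idem (.inl (by rw [← hs, ht, he]))
  · exact idem (.inr (by rw [← ht, hs]))
  · exact idem (.inl (by rw [← hs, ht]))
  · exact idem (.inr (by rw [← hs, ht]))

end Idempotents

/-! ### The criterion for varieties -/

theorem isRegularElement_mul_of_not_holdsIn {S : Type u} [Semigroup S] {i : Identity}
    (hi : ¬ i.HoldsIn IdemPair.{u}) (hS : i.HoldsIn S) {e f : S} (he : e * e = e)
    (hf : f * f = f) : IsRegularElement (e * f) := by
  obtain ⟨φ, hφ⟩ := not_forall.1 hi
  let val : IdemPair.{u} → S := fun a => match a with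
    | .e => e
    | .f => f
    | .ef => e * f
    | .zero => f * e
  have he' : (e : WithOne S) * e = e := by rw [← WithOne.coe_mul, he]
  have hf' : (f : WithOne S) * f = f := by rw [← WithOne.coe_mul, hf]
  have hE : (e : WithOne S) ∈ Submonoid.closure {(e : WithOne S), (f : WithOne S)} :=
    Submonoid.subset_closure (by simp)
  have hF : (f : WithOne S) ∈ Submonoid.closure {(e : WithOne S), (f : WithOne S)} :=
    Submonoid.subset_closure (by simp)
  have hval (a : IdemPair.{u}) : IdemPair.Represents (e : WithOne S) f a (val a) := by
    cases a
    · exact ⟨hE, rfl⟩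
    · exact ⟨hF, rfl⟩
    · exact ⟨mul_mem hE hF, rfl⟩
    · exact ⟨mul_mem hF hE, 1, one_mem _, 1, one_mem _, by simp [val]⟩
  have hw (w : FreeSemigroup ℕ) : IdemPair.Represents (e : WithOne S) f
      (FreeSemigroup.lift φ w) (FreeSemigroup.lift (val ∘ φ) w : S) := by
    induction w using FreeSemigroup.recOnMul with
    | ih1 x => exact hval _
    | ih2 x y hx hy =>
      rw [map_mul, map_mul, WithOne.coe_mul]
      exact hx.mul he' hf' hy
  have h := hw i.rhs
  rw [← hS] at h
  obtain ⟨x, hx⟩ := (hw i.lhs).exists_eq he' hf' h hφ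
  -- The witness lives in `WithOne S`; if it is the adjoined identity, e * f is idempotent and is
  -- its own witness.
  by_cases h1 : x = 1
  · have h2 : e * f = e * f * (e * f) := by
      rw [h1, mul_one] at hx
      exact_mod_cast hx
    exact ⟨e * f, by rw [← h2, ← h2]⟩
  · obtain ⟨x, rfl⟩ := WithOne.ne_one_iff_exists.1 h1
    exact ⟨x, by exact_mod_cast hx⟩

theorem varietyRegularlyClosed_iff (E : List Identity) :
    VarietyRegularlyClosed.{u} E ↔ ∃ i ∈ E, ¬ i.HoldsIn IdemPair.{u} := by
  constructor
  · intro h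
    by_contra! hE
    exact IdemPair.not_regularlyClosed (h _ hE)
  · rintro ⟨i, hiE, hi⟩ S _ hS
    exact regularlyClosed_of_isRegularElement_mul fun e f he hf =>
      isRegularElement_mul_of_not_holdsIn hi (hS i hiE) he hf

/-! ### Values of words in `IdemPair` -/

theorem letters_mul (v w : FreeSemigroup ℕ) : letters (v * w) = letters v ++ letters w := rfl

theorem letters_of (x : ℕ) : letters (FreeSemigroup.of x) = [x] := rfl

namespace IdemPair

variable (φ : ℕ → IdemPair.{u})

theorem mul_lift_ne_zero (w : FreeSemigroup ℕ) (a : IdemPair.{u}) :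
    a * FreeSemigroup.lift φ w ≠ zero ↔
      FreeSemigroup.lift φ w ≠ zero ∧ ∀ x ∈ letters w, a * φ x ≠ zero := by
  induction w using FreeSemigroup.recOnMul generalizing a with
  | ih1 x =>
    simp only [FreeSemigroup.lift_of, letters_of, List.mem_singleton, forall_eq]
    generalize φ x = b
    cases a <;> cases b <;> simp [HMul.hMul, Mul.mul, mul]
  | ih2 x w hx hw =>
    simp only [map_mul, mul_mul_ne_zero, hw a, hw (FreeSemigroup.lift φ (FreeSemigroup.of x)),
      hx a, letters_mul, List.mem_append, or_imp, forall_and]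
    have hm : w.head ∈ letters w := List.mem_cons_self
    exact ⟨fun ⟨⟨_, h1⟩, ⟨h2, h3⟩, h4⟩ => ⟨h4, h1, h3⟩,
      fun ⟨h4, h1, h3⟩ => ⟨⟨left_ne_zero (h4.2 _ hm), h1⟩, ⟨h4.1, h3⟩, h4⟩⟩

theorem lift_ne_zero (w : FreeSemigroup ℕ) :
    FreeSemigroup.lift φ w ≠ zero ↔
      (∀ x ∈ letters w, φ x ≠ zero) ∧ (letters w).Pairwise fun x y => φ x * φ y ≠ zero := by
  induction w using FreeSemigroup.recOnMul with
  | ih1 x => simp [letters_of]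
  | ih2 x w hx hw =>
    have : letters (FreeSemigroup.of x * w) = x :: letters w := rfl
    rw [map_mul, mul_lift_ne_zero, hw, this, List.pairwise_cons, List.forall_mem_cons,
      FreeSemigroup.lift_of]
    have hm : w.head ∈ letters w := List.mem_cons_self
    exact ⟨fun ⟨⟨h1, h2⟩, h3⟩ => ⟨⟨left_ne_zero (h3 _ hm), h1⟩, h3, h2⟩,
      fun ⟨⟨_, h1⟩, h3, h2⟩ => ⟨⟨h1, h2⟩, h3⟩⟩

/-- Neither e nor f is a product involving any other element. So a nonzero value is determined by
the contents alone: it is e, or f, or otherwise e * f. -/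
theorem lift_eq_e (w : FreeSemigroup ℕ) :
    FreeSemigroup.lift φ w = e ↔ ∀ x ∈ letters w, φ x = e := by
  induction w using FreeSemigroup.recOnMul with
  | ih1 x => simp [letters_of]
  | ih2 x w hx hw =>
    simp only [letters_mul, List.mem_append, or_imp, forall_and, ← hx, ← hw, map_mul]
    generalize FreeSemigroup.lift φ w = b
    generalize FreeSemigroup.lift φ _ = a
    cases a <;> cases b <;> simp [HMul.hMul, Mul.mul, mul]

theorem lift_eq_f (w : FreeSemigroup ℕ) :
    FreeSemigroup.lift φ w = f ↔ ∀ x ∈ letters w, φ x = f := by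
  induction w using FreeSemigroup.recOnMul with
  | ih1 x => simp [letters_of]
  | ih2 x w hx hw =>
    simp only [letters_mul, List.mem_append, or_imp, forall_and, ← hx, ← hw, map_mul]
    generalize FreeSemigroup.lift φ w = b
    generalize FreeSemigroup.lift φ _ = a
    cases a <;> cases b <;> simp [HMul.hMul, Mul.mul, mul]

end IdemPair

/-! ### Words as segments of a sequence -/

/-- The number `x` occurs in `g` between the positions `a` and `b`. -/
def OccursIn (g : ℕ → ℕ) (a b x : ℕ) : Prop :=
  ∃ i, a ≤ i ∧ i < b ∧ g i = x

/-- Some occurrence of `x` precedes some occurrence of `y` in `g` between `a` and `b`. -/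
def PrecedesIn (g : ℕ → ℕ) (a b x y : ℕ) : Prop :=
  ∃ i j, a ≤ i ∧ i < j ∧ j < b ∧ g i = x ∧ g j = y

/-- The word `w` is written in `g` from the position `a` on. -/
def WrittenAt (g : ℕ → ℕ) (a : ℕ) (w : FreeSemigroup ℕ) : Prop :=
  (∀ i (h : i < (letters w).length), g (a + i) = (letters w)[i] + 1) ∧
    g (a + (letters w).length) = 0

section Segments

variable {g : ℕ → ℕ} {a b x y : ℕ}

theorem PrecedesIn.left (h : PrecedesIn g a b x y) : OccursIn g a b x := by
  obtain ⟨i, j, h1, h2, h3, h4, -⟩ := h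
  exact ⟨i, h1, h2.trans h3, h4⟩

theorem PrecedesIn.right (h : PrecedesIn g a b x y) : OccursIn g a b y := by
  obtain ⟨i, j, h1, h2, h3, -, h4⟩ := h
  exact ⟨j, h1.trans h2.le, h3, h4⟩

theorem OccursIn.precedesIn_or (hx : OccursIn g a b x) (hy : OccursIn g a b y) (h : x ≠ y) :
    PrecedesIn g a b x y ∨ PrecedesIn g a b y x := by
  obtain ⟨i, h1, h2, rfl⟩ := hx
  obtain ⟨j, h3, h4, rfl⟩ := hy
  rcases lt_trichotomy i j with hij | rfl | hij
  · exact .inl ⟨i, j, h1, hij, h4, rfl, rfl⟩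
  · exact absurd rfl h
  · exact .inr ⟨j, i, h3, hij, h2, rfl, rfl⟩

theorem occursIn_succ (h : a ≤ b) : OccursIn g a (b + 1) x ↔ OccursIn g a b x ∨ g b = x := by
  constructor
  · rintro ⟨i, h1, h2, h3⟩
    rcases Nat.lt_succ_iff_lt_or_eq.1 h2 with h2 | rfl
    · exact .inl ⟨i, h1, h2, h3⟩
    · exact .inr h3
  · rintro (⟨i, h1, h2, h3⟩ | h3)
    · exact ⟨i, h1, by omega, h3⟩
    · exact ⟨b, h, by omega, h3⟩

theorem not_occursIn_self : ¬ OccursIn g a a x := by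
  rintro ⟨i, h1, h2, -⟩
  omega

theorem WrittenAt.forall_letters {w : FreeSemigroup ℕ} (h : WrittenAt g a w) (P : ℕ → Prop) :
    (∀ x ∈ letters w, P (x + 1)) ↔ ∀ x, OccursIn g a (a + (letters w).length) x → P x := by
  rw [List.forall_mem_iff_forall_getElem]
  constructor
  · rintro hP x ⟨i, h1, h2, rfl⟩
    obtain ⟨i, rfl⟩ := Nat.exists_eq_add_of_le h1
    have hi : i < (letters w).length := by omega
    rw [h.1 i hi]
    exact hP i hi
  · intro hP i hi
    exact hP _ ⟨a + i, by omega, by omega, h.1 i hi⟩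

theorem WrittenAt.pairwise_letters {w : FreeSemigroup ℕ} (h : WrittenAt g a w)
    (R : ℕ → ℕ → Prop) :
    ((letters w).Pairwise fun x y => R (x + 1) (y + 1)) ↔
      ∀ x y, PrecedesIn g a (a + (letters w).length) x y → R x y := by
  rw [List.pairwise_iff_getElem]
  constructor
  · rintro hP x y ⟨i, j, h1, h2, h3, rfl, rfl⟩
    obtain ⟨i, rfl⟩ := Nat.exists_eq_add_of_le h1
    obtain ⟨j, rfl⟩ := Nat.exists_eq_add_of_le (h1.trans h2.le)
    have hi : i < (letters w).length := by omega
    have hj : j < (letters w).length := by omega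
    rw [h.1 i hi, h.1 j hj]
    exact hP i j hi hj (by omega)
  · intro hP i j hi hj hij
    exact hP _ _ ⟨a + i, a + j, by omega, by omega, by omega, h.1 i hi, h.1 j hj⟩

end Segments

/-! ### Block codes -/

/-- Cut the segment of `g` between `a` and `b` into as many blocks with disjoint contents as
possible. The code of a letter in the `m`-th block (`m = 1, 2, …`) is `2 * m + 1` if the block has
length one and `2 * m` otherwise. The code of a letter that does not occur is `0`. -/
structure IsBlockCode (g : ℕ → ℕ) (a b : ℕ) (c : ℕ → ℕ) : Prop where
  eq_zero : ∀ x, ¬ OccursIn g a b x → c x = 0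
  pos : ∀ x, OccursIn g a b x → 0 < c x / 2
  order : ∀ x y, PrecedesIn g a b x y → c x / 2 < c y / 2 ∨ c x = c y ∧ c x % 2 = 0
  connected : ∀ x y, OccursIn g a b x → OccursIn g a b y → c x = c y → c x % 2 = 0 →
    Relation.TransGen (PrecedesIn g a b) x y
  attained : ∀ x, OccursIn g a b x → ∀ m, 0 < m → m ≤ c x / 2 → ∃ y, OccursIn g a b y ∧ c y / 2 = m

namespace IsBlockCode

variable {g : ℕ → ℕ} {a b a' b' : ℕ} {c c' : ℕ → ℕ}

theorem occursIn_iff (h : IsBlockCode g a b c) (x : ℕ) : OccursIn g a b x ↔ c x ≠ 0 := by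
  constructor
  · intro hx h0
    have := h.pos x hx
    rw [h0] at this
    exact absurd this (by norm_num)
  · intro hx
    by_contra h0
    exact hx (h.eq_zero x h0)

/-- Two different letters that occur are comparable by precedence, and `order` excludes the backward
direction across blocks. -/
theorem transGen_iff (h : IsBlockCode g a b c) {x y : ℕ} (hx : OccursIn g a b x)
    (hy : OccursIn g a b y) : Relation.TransGen (PrecedesIn g a b) x y ↔
      c x / 2 < c y / 2 ∨ c x = c y ∧ c x % 2 = 0 := by
  constructor
  · intro hxy
    clear hy
    induction hxy with
    | single h1 => exact h.order _ _ h1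
    | tail _ h1 ih =>
      have := h.order _ _ h1
      omega
  · rintro (h1 | h1)
    · have hne : x ≠ y := by rintro rfl; omega
      rcases hx.precedesIn_or hy hne with h2 | h2
      · exact .single h2
      · have := h.order _ _ h2
        omega
    · exact h.connected x y hx hy h1.1 h1.2

/-- Block codes depend only on the letters and on the order of their occurrences. -/
theorem eq_of_transGen (h : IsBlockCode g a b c) (h' : IsBlockCode g a' b' c')
    (hocc : ∀ x, OccursIn g a b x ↔ OccursIn g a' b' x)
    (hT : ∀ x y, OccursIn g a b x → OccursIn g a b y →
      (c x / 2 < c y / 2 ∨ c x = c y ∧ c x % 2 = 0 ↔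
        c' x / 2 < c' y / 2 ∨ c' x = c' y ∧ c' x % 2 = 0)) : c = c' := by
  have key : ∀ n x, OccursIn g a b x → c x / 2 = n → c' x / 2 = n := by
    intro n
    induction n using Nat.strong_induction_on with
    | _ n ih =>
      intro x hx hn
      have hx' := (hocc x).1 hx
      have hpos := h.pos x hx
      have hpos' := h'.pos x hx'
      -- Lying in a strictly earlier block is the asymmetric part of the relation in `hT`. As block
      -- numbers have no gaps (`attained`), this part determines them.
      have lt_iff (y) (hy : OccursIn g a b y) : c y / 2 < c x / 2 ↔ c' y / 2 < c' x / 2 := by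
        have h1 := hT y x hy hx
        have h2 := hT x y hx hy
        omega
      rcases lt_trichotomy (c' x / 2) n with hlt | heq | hlt
      · obtain ⟨y, hy, hym⟩ := h.attained x hx (c' x / 2) hpos' (by omega)
        have h1 := ih _ hlt y hy hym
        have h2 := (lt_iff y hy).1 (by omega)
        omega
      · exact heq
      · obtain ⟨y, hy, hym⟩ := h'.attained x hx' n (by omega) (by omega)
        have hy' := (hocc y).2 hy
        have h1 := (lt_iff y hy').2 (by omega)
        have h2 := ih (c y / 2) (by omega) y hy' rfl
        omega
  funext x
  by_cases hx : OccursIn g a b x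
  · have h1 := key _ x hx rfl
    -- The parity records whether x is related to itself.
    have h2 := hT x x hx hx
    omega
  · rw [h.eq_zero x hx, h'.eq_zero x (by rwa [← hocc])]

end IsBlockCode

/-! ### Identities of `IdemPair` and block codes -/

namespace IdemPair

variable {g : ℕ → ℕ} {a a' : ℕ} {c c' : ℕ → ℕ} {v w : FreeSemigroup ℕ}

theorem lift_ne_zero_iff (h : WrittenAt g a w) (ψ : ℕ → IdemPair.{u}) :
    FreeSemigroup.lift (fun x => ψ (x + 1)) w ≠ zero ↔
      (∀ x, OccursIn g a (a + (letters w).length) x → ψ x ≠ zero) ∧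
      ∀ x y, PrecedesIn g a (a + (letters w).length) x y → ψ x * ψ y ≠ zero := by
  rw [lift_ne_zero, h.forall_letters (fun x => ψ x ≠ zero),
    h.pairwise_letters (fun x y => ψ x * ψ y ≠ zero)]

/-- A substitution that distinguishes the blocks before the `m`-th one from those after it, and
the `m`-th one from both if it has length one. -/
def separator (c : ℕ → ℕ) (m x : ℕ) : IdemPair.{u} :=
  if c x / 2 < m then e else if m < c x / 2 then f else if c x % 2 = 0 then e else ef

theorem separator_ne_zero (c : ℕ → ℕ) (m x : ℕ) : separator.{u} c m x ≠ zero := by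
  unfold separator
  split_ifs <;> simp

theorem separator_mul_separator (c : ℕ → ℕ) (m x y : ℕ)
    (h : c x / 2 < c y / 2 ∨ c x = c y ∧ c x % 2 = 0) :
    separator.{u} c m x * separator c m y ≠ zero := by
  unfold separator
  split_ifs <;> first | omega | simp [HMul.hMul, Mul.mul, mul]

/-- The cut is made at the block of y. If x lies later, it goes to f and y to e or ef; if both lie
in the same block of length one, both go to ef, whose square is zero. -/
theorem separator_mul_separator_eq_zero (c : ℕ → ℕ) (x y : ℕ)
    (h : c y / 2 < c x / 2 ∨ c x = c y ∧ c x % 2 = 1) :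
    separator.{u} c (c y / 2) x * separator c (c y / 2) y = zero := by
  unfold separator
  split_ifs <;> first | omega | simp [HMul.hMul, Mul.mul, mul]

theorem transGen_mul_ne_zero {r : ℕ → ℕ → Prop} {ψ : ℕ → IdemPair.{u}}
    (h : ∀ x y, r x y → ψ x * ψ y ≠ zero) {x y : ℕ} (hxy : Relation.TransGen r x y) :
    ψ x * ψ y ≠ zero := by
  induction hxy with
  | single h1 => exact h _ _ h1
  | tail _ h1 ih => exact mul_ne_zero_trans ih (h _ _ h1)

/-- Equal codes give equal contents and equal transitive closures, so nonvanishing passes from v to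
w; the contents then decide between e, f and ef. -/
theorem lift_eq_of_code_eq (hv : WrittenAt g a v) (hw : WrittenAt g a' w)
    (hc : IsBlockCode g a (a + (letters v).length) c)
    (hc' : IsBlockCode g a' (a' + (letters w).length) c) (ψ : ℕ → IdemPair.{u})
    (h0 : FreeSemigroup.lift (fun x => ψ (x + 1)) v ≠ zero) :
    FreeSemigroup.lift (fun x => ψ (x + 1)) v = FreeSemigroup.lift (fun x => ψ (x + 1)) w := by
  have hocc (x) := (hc.occursIn_iff x).trans (hc'.occursIn_iff x).symm
  have h0' : FreeSemigroup.lift (fun x => ψ (x + 1)) w ≠ zero := by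
    rw [lift_ne_zero_iff hv] at h0
    rw [lift_ne_zero_iff hw]
    refine ⟨fun x hx => h0.1 x ((hocc x).2 hx), fun x y hxy => ?_⟩
    exact transGen_mul_ne_zero h0.2 ((hc.transGen_iff ((hocc x).2 hxy.left)
      ((hocc y).2 hxy.right)).2 (hc'.order x y hxy))
  have he : FreeSemigroup.lift (fun x => ψ (x + 1)) v = e ↔
      FreeSemigroup.lift (fun x => ψ (x + 1)) w = e := by
    rw [lift_eq_e, lift_eq_e, hv.forall_letters (fun x => ψ x = e),
      hw.forall_letters (fun x => ψ x = e)]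
    exact forall_congr' fun x => by rw [hocc]
  have hf : FreeSemigroup.lift (fun x => ψ (x + 1)) v = f ↔
      FreeSemigroup.lift (fun x => ψ (x + 1)) w = f := by
    rw [lift_eq_f, lift_eq_f, hv.forall_letters (fun x => ψ x = f),
      hw.forall_letters (fun x => ψ x = f)]
    exact forall_congr' fun x => by rw [hocc]
  revert h0 h0' he hf
  generalize FreeSemigroup.lift (fun x => ψ (x + 1)) v = p
  generalize FreeSemigroup.lift (fun x => ψ (x + 1)) w = q
  cases p <;> cases q <;> simp

/-- If x were related to y in v but not in w, the separator at the block of y in w would be nonzero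
on w; on v it would vanish, by transitivity from x to y. -/
theorem code_order_of_lift_eq (hv : WrittenAt g a v) (hw : WrittenAt g a' w)
    (hc : IsBlockCode g a (a + (letters v).length) c)
    (hc' : IsBlockCode g a' (a' + (letters w).length) c')
    (h : ∀ φ : ℕ → IdemPair.{u}, FreeSemigroup.lift φ v = FreeSemigroup.lift φ w) {x y : ℕ}
    (hx : OccursIn g a (a + (letters v).length) x) (hy : OccursIn g a (a + (letters v).length) y)
    (hx' : OccursIn g a' (a' + (letters w).length) x)
    (hy' : OccursIn g a' (a' + (letters w).length) y)
    (hxy : c x / 2 < c y / 2 ∨ c x = c y ∧ c x % 2 = 0) :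
    c' x / 2 < c' y / 2 ∨ c' x = c' y ∧ c' x % 2 = 0 := by
  by_contra hn
  have hn' : c' y / 2 < c' x / 2 ∨ c' x = c' y ∧ c' x % 2 = 1 := by
    by_cases hne : x = y
    · subst hne
      omega
    · rcases hx'.precedesIn_or hy' hne with h2 | h2
      · have := hc'.order _ _ h2
        omega
      · have := hc'.order _ _ h2
        omega
  have h1 : FreeSemigroup.lift (fun z => separator.{u} c' (c' y / 2) (z + 1)) w ≠ zero := by
    rw [lift_ne_zero_iff hw]
    exact ⟨fun z _ => separator_ne_zero _ _ _,
      fun z z' hz => separator_mul_separator _ _ _ _ (hc'.order _ _ hz)⟩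
  rw [← h, lift_ne_zero_iff hv] at h1
  exact transGen_mul_ne_zero h1.2 ((hc.transGen_iff hx hy).2 hxy)
    (separator_mul_separator_eq_zero _ _ _ hn')

theorem occursIn_of_lift_eq (hv : WrittenAt g a v) (hw : WrittenAt g a' w)
    (h : ∀ φ : ℕ → IdemPair.{u}, FreeSemigroup.lift φ v = FreeSemigroup.lift φ w) {x : ℕ}
    (hx : OccursIn g a (a + (letters v).length) x) :
    OccursIn g a' (a' + (letters w).length) x := by
  by_contra hn
  -- Killing only the letter missing from w gives w the value e, which v cannot have.
  let ψ : ℕ → IdemPair.{u} := fun z => if z = x then zero else e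
  have h1 : FreeSemigroup.lift (fun z => ψ (z + 1)) w = e := by
    rw [lift_eq_e, hw.forall_letters (fun z => ψ z = e)]
    intro z hz
    exact if_neg fun hzx : z = x => hn (hzx ▸ hz)
  rw [← h, lift_eq_e, hv.forall_letters (fun z => ψ z = e)] at h1
  have := h1 x hx
  simp [ψ] at this

/-- An identity holds in `IdemPair` if and only if its two sides have the same block code. -/
theorem holdsIn_iff {i : Identity} (hl : WrittenAt g a i.lhs) (hr : WrittenAt g a' i.rhs)
    (hc : IsBlockCode g a (a + (letters i.lhs).length) c)
    (hc' : IsBlockCode g a' (a' + (letters i.rhs).length) c') :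
    i.HoldsIn IdemPair.{u} ↔ c = c' := by
  constructor
  · intro h
    have hocc (x) : OccursIn g a (a + (letters i.lhs).length) x ↔
        OccursIn g a' (a' + (letters i.rhs).length) x :=
      ⟨occursIn_of_lift_eq hl hr h, occursIn_of_lift_eq hr hl fun φ => (h φ).symm⟩
    refine hc.eq_of_transGen hc' hocc fun x y hx hy => ⟨?_, ?_⟩
    · exact code_order_of_lift_eq hl hr hc hc' h hx hy ((hocc x).1 hx) ((hocc y).1 hy)
    · exact code_order_of_lift_eq hr hl hc' hc (fun φ => (h φ).symm) ((hocc x).1 hx)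
        ((hocc y).1 hy) hx hy
  · rintro rfl φ
    -- Letters are written shifted by one, so φ is reindexed by the written numbers.
    have hφ : φ = fun x => (fun n => φ (n - 1)) (x + 1) := by
      funext x
      simp
    rw [hφ]
    by_cases h0 : FreeSemigroup.lift (fun x => (fun n => φ (n - 1)) (x + 1)) i.lhs = zero
    · by_cases h0' : FreeSemigroup.lift (fun x => (fun n => φ (n - 1)) (x + 1)) i.rhs = zero
      · rw [h0, h0']
      · exact (lift_eq_of_code_eq hr hl hc' hc (fun n => φ (n - 1)) h0').symm
    · exact lift_eq_of_code_eq hl hr hc hc' (fun n => φ (n - 1)) h0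

end IdemPair

/-! ### Computing block codes in one pass -/

theorem precedesIn_succ {g : ℕ → ℕ} {a b x y : ℕ} (h : a ≤ b) :
    PrecedesIn g a (b + 1) x y ↔ PrecedesIn g a b x y ∨ OccursIn g a b x ∧ g b = y := by
  constructor
  · rintro ⟨i, j, h1, h2, h3, h4, h5⟩
    rcases Nat.lt_succ_iff_lt_or_eq.1 h3 with h3 | rfl
    · exact .inl ⟨i, j, h1, h2, h3, h4, h5⟩
    · exact .inr ⟨⟨i, h1, h2, h4⟩, h5⟩
  · rintro (⟨i, j, h1, h2, h3, h4, h5⟩ | ⟨⟨i, h1, h2, h3⟩, h4⟩)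
    · exact ⟨i, j, h1, h2, by omega, h4, h5⟩
    · exact ⟨i, b, h1, h2, by omega, h3, h4⟩

/-- The function `l` gives the position after the last occurrence of each letter between `a` and
`b`. -/
def IsLastOccurrence (g : ℕ → ℕ) (a b : ℕ) (l : ℕ → ℕ) : Prop :=
  ∀ x, OccursIn g a b x → (∃ i, a ≤ i ∧ i < b ∧ g i = x ∧ l x = i + 1) ∧
    ∀ i, a ≤ i → i < b → g i = x → i < l x

/-- Letters that have not occurred are unconstrained, so the table of last occurrences is never
cleared between words. -/
theorem IsLastOccurrence.init (g : ℕ → ℕ) (a : ℕ) (l : ℕ → ℕ) : IsLastOccurrence g a a l :=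
  fun _ hx => absurd hx not_occursIn_self

theorem IsLastOccurrence.succ {g : ℕ → ℕ} {a b : ℕ} {l : ℕ → ℕ} (h : IsLastOccurrence g a b l)
    (hab : a ≤ b) : IsLastOccurrence g a (b + 1) (Function.update l (g b) (b + 1)) := by
  intro x hx
  by_cases hxb : x = g b
  · subst hxb
    rw [Function.update_self]
    exact ⟨⟨b, hab, by omega, rfl, rfl⟩, fun i _ h2 _ => h2⟩
  · rw [Function.update_of_ne hxb]
    have hx' : OccursIn g a b x := by
      rcases (occursIn_succ hab).1 hx with h1 | h1
      · exact h1
      · exact absurd h1.symm hxb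
    obtain ⟨⟨i, h1, h2, h3, h4⟩, h5⟩ := h x hx'
    refine ⟨⟨i, h1, by omega, h3, h4⟩, fun j h6 h7 h8 => h5 j h6 ?_ h8⟩
    have : j ≠ b := by rintro rfl; exact hxb h8.symm
    omega

/-- The state of the computation of the block code after reading the segment from `a` up to `p`:
the current block extends at least up to `R`, its code is `C` or `C + 1`, and the codes of the
letters read so far are given by `c`. -/
structure BlockCodeUpTo (g : ℕ → ℕ) (a b : ℕ) (l : ℕ → ℕ) (p R C : ℕ) (c : ℕ → ℕ) : Prop where
  le : a ≤ p
  le_reach : p ≤ R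
  reach_le : R ≤ b
  even : C % 2 = 0
  bound : C ≤ 2 * (p - a)
  eq_zero : ∀ x, ¬ OccursIn g a p x → c x = 0
  pos : ∀ x, OccursIn g a p x → 0 < c x / 2 ∧ c x / 2 ≤ C / 2
  last_le : ∀ x, OccursIn g a p x → l x ≤ R
  eq_current : ∀ x, OccursIn g a p x → p < l x → c x = C
  eq_of_open : p < R → ∀ x, OccursIn g a p x → c x / 2 = C / 2 → c x = C
  exists_reach : p < R → ∃ z, OccursIn g a p z ∧ l z = R
  order : ∀ x y, PrecedesIn g a p x y → c x / 2 < c y / 2 ∨ c x = c y ∧ c x % 2 = 0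
  connected : ∀ x y, OccursIn g a p x → OccursIn g a p y → c x = c y → c x % 2 = 0 →
    Relation.TransGen (PrecedesIn g a b) x y
  attained : ∀ m, 0 < m → m ≤ C / 2 → ∃ y, OccursIn g a p y ∧ c y / 2 = m

namespace BlockCodeUpTo

variable {g : ℕ → ℕ} {a b p R C : ℕ} {l c : ℕ → ℕ}

theorem init (hab : a ≤ b) (l : ℕ → ℕ) : BlockCodeUpTo g a b l a a 0 fun _ => 0 where
  le := le_rfl
  le_reach := le_rfl
  reach_le := hab
  even := rfl
  bound := by omega
  eq_zero _ _ := rfl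
  pos _ h := absurd h not_occursIn_self
  last_le _ h := absurd h not_occursIn_self
  eq_current _ h := absurd h not_occursIn_self
  eq_of_open h := absurd h (lt_irrefl _)
  exists_reach h := absurd h (lt_irrefl _)
  order _ _ h := absurd h.left not_occursIn_self
  connected _ _ h := absurd h not_occursIn_self
  attained _ h1 h2 := absurd (h1.trans_le h2) (lt_irrefl _)

theorem isBlockCode (h : BlockCodeUpTo g a b l b R C c) : IsBlockCode g a b c where
  eq_zero := h.eq_zero
  pos x hx := (h.pos x hx).1
  order := h.order
  connected := h.connected
  attained x hx m hm hmx := h.attained m hm (hmx.trans (h.pos x hx).2)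

theorem code_le (h : BlockCodeUpTo g a b l p R C c) (x : ℕ) : c x ≤ C + 1 := by
  by_cases hx : OccursIn g a p x
  · have := h.pos x hx
    omega
  · rw [h.eq_zero x hx]
    omega

theorem last_bounds (hl : IsLastOccurrence g a b l) (hap : a ≤ p) (hpb : p < b) :
    p < l (g p) ∧ l (g p) ≤ b := by
  obtain ⟨⟨i, _, h2, _, h4⟩, h5⟩ := hl (g p) ⟨p, hap, hpb, rfl⟩
  exact ⟨h5 p hap hpb rfl, by omega⟩

/-- Reading the first letter of a block. -/
theorem succ_of_closed (hl : IsLastOccurrence g a b l) (hpb : p < b)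
    (h : BlockCodeUpTo g a b l p R C c) (hR : R = p) :
    BlockCodeUpTo g a b l (p + 1) (l (g p)) (C + 2)
      (Function.update c (g p) (if l (g p) = p + 1 then C + 2 + 1 else C + 2)) := by
  obtain ⟨h1, h2⟩ := last_bounds hl h.le hpb
  have heven := h.even
  -- All letters read so far have ended by R = p, so the letter at p is new.
  have hnot : ¬ OccursIn g a p (g p) := fun hx => by
    have := h.last_le _ hx
    omega
  have hne {x} (hx : OccursIn g a p x) : x ≠ g p := by
    rintro rfl
    exact hnot hx
  have occ {x} (hx : OccursIn g a (p + 1) x) : OccursIn g a p x ∨ x = g p :=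
    ((occursIn_succ h.le).1 hx).imp id Eq.symm
  have hself : OccursIn g a (p + 1) (g p) := (occursIn_succ h.le).2 (.inr rfl)
  set d := if l (g p) = p + 1 then C + 2 + 1 else C + 2 with hd
  have hd2 : d / 2 = C / 2 + 1 := by
    rw [hd]
    split_ifs <;> omega
  have hdC : p + 1 < l (g p) → d = C + 2 := fun h3 => by
    rw [hd, if_neg (by omega)]
  have hdeven : d % 2 = 0 → p + 1 < l (g p) := fun h3 => by
    rw [hd] at h3
    split_ifs at h3 <;> omega
  clear_value d
  have hself' : Function.update c (g p) d (g p) = d := Function.update_self ..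
  have hold {x} (hx : OccursIn g a p x) : Function.update c (g p) d x = c x :=
    Function.update_of_ne (hne hx) ..
  refine
    { le := h.le.trans (Nat.le_succ p), le_reach := h1, reach_le := h2, even := by omega,
      bound := ?_, eq_zero := ?_, pos := ?_, last_le := ?_, eq_current := ?_, eq_of_open := ?_,
      exists_reach := fun _ => ⟨g p, hself, rfl⟩, order := ?_, connected := ?_, attained := ?_ }
  · have := h.bound
    have := h.le
    omega
  · intro x hx
    rw [occursIn_succ h.le, not_or] at hx
    rw [Function.update_of_ne (Ne.symm hx.2)]
    exact h.eq_zero x hx.1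
  · intro x hx
    rcases occ hx with hx | rfl
    · rw [hold hx]
      have := h.pos x hx
      omega
    · rw [hself']
      omega
  · intro x hx
    rcases occ hx with hx | rfl
    · have := h.last_le x hx
      omega
    · exact le_rfl
  · intro x hx hlt
    rcases occ hx with hx | rfl
    · have := h.last_le x hx
      omega
    · rw [hself', hdC hlt]
  · intro hlt x hx hxC
    rcases occ hx with hx | rfl
    · rw [hold hx] at hxC
      have := h.pos x hx
      omega
    · rw [hself', hdC hlt]
  · intro x y hxy
    rcases (precedesIn_succ h.le).1 hxy with hxy | ⟨hx, rfl⟩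
    · rw [hold hxy.left, hold hxy.right]
      exact h.order x y hxy
    · rw [hold hx, hself']
      have := h.pos x hx
      omega
  · intro x y hx hy hxy heven
    rcases occ hx with hx | rfl
    · rcases occ hy with hy | rfl
      · rw [hold hx] at hxy heven
        rw [hold hy] at hxy
        exact h.connected x y hx hy hxy heven
      · rw [hold hx, hself'] at hxy
        have := h.pos x hx
        omega
    · rcases occ hy with hy | rfl
      · rw [hold hy, hself'] at hxy
        have := h.pos y hy
        omega
      · rw [hself'] at heven
        have h3 := hdeven heven
        -- An even code means that the letter recurs later, so it precedes itself.
        obtain ⟨⟨i, h4, h5, h6, h7⟩, -⟩ := hl (g p) ⟨p, h.le, hpb, rfl⟩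
        exact .single ⟨p, i, h.le, by omega, h5, rfl, h6⟩
  · intro m hm hmC
    by_cases hmd : m = d / 2
    · exact ⟨g p, hself, by rw [hself', hmd]⟩
    · obtain ⟨y, hy, hym⟩ := h.attained m hm (by omega)
      exact ⟨y, (occursIn_succ h.le).2 (.inl hy), by rw [hold hy, hym]⟩

/-- Reading a letter inside a block. -/
theorem succ_of_open (hl : IsLastOccurrence g a b l) (hpb : p < b)
    (h : BlockCodeUpTo g a b l p R C c) (hR : p < R) :
    BlockCodeUpTo g a b l (p + 1) (max R (l (g p))) C (Function.update c (g p) C) := by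
  obtain ⟨h1, h2⟩ := last_bounds hl h.le hpb
  -- The letter z keeps the block open: it has occurred before p and occurs again at p or later, so
  -- it is related to the letter at p in both directions.
  obtain ⟨z, hz, hzR⟩ := h.exists_reach hR
  have hzC : c z = C := h.eq_current z hz (by omega)
  have heven := h.even
  have hzpos := h.pos z hz
  have occ {x} (hx : OccursIn g a (p + 1) x) : OccursIn g a p x ∨ x = g p :=
    ((occursIn_succ h.le).1 hx).imp id Eq.symm
  have hself : OccursIn g a (p + 1) (g p) := (occursIn_succ h.le).2 (.inr rfl)
  have hself' : Function.update c (g p) C (g p) = C := Function.update_self ..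
  -- If the letter at p was read before, it is still unfinished, so its code already is C and the
  -- update changes nothing.
  have hold {x} (hx : OccursIn g a p x) : Function.update c (g p) C x = c x := by
    by_cases hxp : x = g p
    · subst hxp
      rw [hself', h.eq_current _ hx h1]
    · exact Function.update_of_ne hxp ..
  obtain ⟨⟨i, hi1, hi2, hi3, hi4⟩, -⟩ := hl z (by
    obtain ⟨i, h3, h4, h5⟩ := hz
    exact ⟨i, h3, by omega, h5⟩)
  have hzg : PrecedesIn g a b z (g p) := by
    obtain ⟨j, h3, h4, h5⟩ := hz
    exact ⟨j, p, h3, h4, hpb, h5, rfl⟩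
  have hgz : Relation.TransGen (PrecedesIn g a b) (g p) z := by
    rcases Nat.lt_or_ge p i with hlt | hge
    · exact .single ⟨p, i, h.le, hlt, hi2, rfl, hi3⟩
    · have : i = p := by omega
      subst this
      rw [hi3] at hzg ⊢
      exact .single hzg
  refine
    { le := h.le.trans (Nat.le_succ p), le_reach := by omega, reach_le := max_le h.reach_le h2,
      even := heven, bound := h.bound.trans (by omega), eq_zero := ?_, pos := ?_, last_le := ?_,
      eq_current := ?_, eq_of_open := ?_, exists_reach := ?_, order := ?_, connected := ?_,
      attained := ?_ }
  · intro x hx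
    rw [occursIn_succ h.le, not_or] at hx
    rw [Function.update_of_ne (Ne.symm hx.2)]
    exact h.eq_zero x hx.1
  · intro x hx
    rcases occ hx with hx | rfl
    · rw [hold hx]
      exact h.pos x hx
    · rw [hself']
      omega
  · intro x hx
    rcases occ hx with hx | rfl
    · exact (h.last_le x hx).trans (le_max_left _ _)
    · exact le_max_right _ _
  · intro x hx hlt
    rcases occ hx with hx | rfl
    · rw [hold hx]
      exact h.eq_current x hx (by omega)
    · exact hself'
  · intro hlt x hx hxC
    rcases occ hx with hx | rfl
    · rw [hold hx] at hxC ⊢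
      exact h.eq_of_open hR x hx hxC
    · exact hself'
  · intro hlt
    rcases max_choice R (l (g p)) with hm | hm
    · exact ⟨z, (occursIn_succ h.le).2 (.inl hz), by rw [hm, hzR]⟩
    · exact ⟨g p, hself, hm.symm⟩
  · intro x y hxy
    rcases (precedesIn_succ h.le).1 hxy with hxy | ⟨hx, rfl⟩
    · rw [hold hxy.left, hold hxy.right]
      exact h.order x y hxy
    · rw [hold hx, hself']
      have h3 := h.pos x hx
      have h4 := h.eq_of_open hR x hx
      omega
  · intro x y hx hy hxy heven
    rcases occ hx with hx | rfl
    · rw [hold hx] at hxy heven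
      rcases occ hy with hy | rfl
      · rw [hold hy] at hxy
        exact h.connected x y hx hy hxy heven
      · rw [hself'] at hxy
        exact (h.connected x z hx hz (by omega) heven).tail hzg
    · rw [hself'] at hxy heven
      rcases occ hy with hy | rfl
      · rw [hold hy] at hxy
        exact hgz.trans (h.connected z y hz hy (by omega) (by omega))
      · exact hgz.tail hzg
  · intro m hm hmC
    obtain ⟨y, hy, hym⟩ := h.attained m hm hmC
    exact ⟨y, (occursIn_succ h.le).2 (.inl hy), by rw [hold hy, hym]⟩

end BlockCodeUpTo

namespace RAM

/-! ### Running programs -/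

/-- The program `c` started in `s` halts after at most `T` steps in a state that satisfies `Q`. -/
def Run (W : ℕ) (c : Program) (s : Store) (T : ℕ) (Q : Store → Prop) : Prop :=
  ∃ t s', t ≤ T ∧ Exec W c s t s' ∧ Q s'

section Run

variable {W T T₁ T₂ : ℕ} {b : Test} {c d : Program} {s s' : Store} {P Q : Store → Prop}

theorem Run.mono (h : Run W c s T₁ P) (hT : T₁ ≤ T₂) (hQ : ∀ s', P s' → Q s') :
    Run W c s T₂ Q := by
  obtain ⟨t, s', h1, h2, h3⟩ := h
  exact ⟨t, s', h1.trans hT, h2, hQ _ h3⟩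

theorem Run.seq (hc : Run W c s T₁ P) (hd : ∀ s', P s' → Run W d s' T₂ Q) :
    Run W (.seq c d) s (T₁ + T₂) Q := by
  obtain ⟨t, s', h1, h2, h3⟩ := hc
  obtain ⟨t', s'', h4, h5, h6⟩ := hd s' h3
  exact ⟨t + t', s'', by omega, .seq h2 h5, h6⟩

theorem Run.instr (hc : Exec W c s 1 s') (hQ : Q s') : Run W c s (T + 1) Q :=
  ⟨1, s', by omega, hc, hQ⟩

theorem Run.instr_seq (hc : Exec W c s 1 s') (hd : Run W d s' T Q) :
    Run W (.seq c d) s (T + 1) Q :=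
  let ⟨t, s'', h1, h2, h3⟩ := hd
  ⟨1 + t, s'', by omega, .seq hc h2, h3⟩

theorem Run.ite (hc : b.Holds s → Run W c s T Q) (hd : ¬ b.Holds s → Run W d s T Q) :
    Run W (.ite b c d) s (T + 1) Q := by
  by_cases hb : b.Holds s
  · obtain ⟨t, s', h1, h2, h3⟩ := hc hb
    exact ⟨1 + t, s', by omega, .iteTrue hb h2, h3⟩
  · obtain ⟨t, s', h1, h2, h3⟩ := hd hb
    exact ⟨1 + t, s', by omega, .iteFalse hb h2, h3⟩

theorem Run.loop_true (hb : b.Holds s) (hc : Run W c s T₁ P)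
    (hl : ∀ s', P s' → Run W (.loop b c) s' T₂ Q) : Run W (.loop b c) s (T₁ + T₂ + 1) Q := by
  obtain ⟨t, s', h1, h2, h3⟩ := hc
  obtain ⟨t', s'', h4, h5, h6⟩ := hl s' h3
  exact ⟨1 + t + t', s'', by omega, .loopTrue hb h2 h5, h6⟩

theorem Run.loop_false (hb : ¬ b.Holds s) (hQ : Q s) : Run W (.loop b c) s 1 Q :=
  ⟨1, s, le_rfl, .loopFalse hb, hQ⟩

end Run

section Store

variable (s : Store) (r q v a i : ℕ)

@[simp] theorem Store.reg_setReg : (s.setReg r v).reg q = if q = r then v else s.reg q := by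
  simp [Store.setReg, Function.update_apply]

@[simp] theorem Store.arr_setReg : (s.setReg r v).arr = s.arr := rfl

@[simp] theorem Store.reg_setArr : (s.setArr a i v).reg = s.reg := rfl

@[simp] theorem Store.arr_setArr :
    (s.setArr a i v).arr q = if q = a then Function.update (s.arr a) i v else s.arr q := by
  simp only [Store.setArr, Function.update_apply]

end Store

/-! ### The program

The register `0` holds the length of the input and `1` the answer; `2` and `3` hold the constants
one and zero; `4` holds the current position and `5` the entry of the input there; `6` and `7` hold
the positions at which the two sides of the current identity start; `8`, `9` are the variables of
the computation of a block code, and `10`, `11`, `12` are auxiliary. The array `1` holds last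
occurrences, the arrays `2` and `3` the block codes of the two sides of the current identity. -/

/-- Execute `body` for all letters of the word that starts at the position in the register `r`. -/
def wordLoop (r : ℕ) (body : Program) : Program :=
  .seq (.copy 4 r) (.seq (.load 5 0 4)
    (.loop (.lt 3 5) (.seq body (.seq (.add 4 4 2) (.load 5 0 4)))))

def lastOccurrenceStep : Program :=
  .seq (.add 11 4 2) (.store 1 5 11)

/-- Register 8 is the reach R of the current block and 9 its even code C; R equal to the position
means that the block is closed and a new one starts. -/
def blockCodeStep (k : ℕ) : Program :=
  .seq (.load 10 1 5) (.ite (.eq 8 4)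
    (.seq (.add 9 9 2) (.seq (.add 9 9 2) (.seq (.copy 8 10) (.seq (.add 11 4 2)
      (.ite (.eq 8 11) (.seq (.add 12 9 2) (.store k 5 12)) (.store k 5 9))))))
    (.ite (.lt 8 10) (.seq (.copy 8 10) (.store k 5 9)) (.store k 5 9)))

/-- Write the block code of the word that starts at the position in the register `r` into the
array `k`. -/
def blockCode (r k : ℕ) : Program :=
  .seq (wordLoop r lastOccurrenceStep)
    (.seq (.const 9 0) (.seq (.copy 8 r) (wordLoop r (blockCodeStep k))))

/-- Compare the codes of a letter, and clear them. -/
def compareStep : Program :=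
  .seq (.load 10 2 5) (.seq (.load 12 3 5) (.seq (.store 2 5 3) (.seq (.store 3 5 3)
    (.ite (.eq 10 12) .skip (.const 1 1)))))

/-- Comparing along both words covers every letter with a nonzero code and leaves both code tables
zero. The last pass ends at the separator of the right side, hence the final increment. -/
def processIdentity : Program :=
  .seq (.copy 6 4) (.seq (blockCode 6 2) (.seq (.add 4 4 2) (.seq (.copy 7 4)
    (.seq (blockCode 7 3) (.seq (wordLoop 6 compareStep) (.seq (wordLoop 7 compareStep)
      (.add 4 4 2)))))))

def decisionProgram : Program :=
  .seq (.const 2 1) (.seq (.loop (.lt 4 0) processIdentity) (.copy 0 1))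

/-! ### Correctness -/

/-- The contents of the registers and of the input array that are not changed by the treatment of
single letters. -/
structure Frame (g : ℕ → ℕ) (n : ℕ) (F : Prop) (a a' : ℕ) (s : Store) : Prop where
  length : s.reg 0 = n
  answer_true : F → s.reg 1 = 1
  answer_false : ¬ F → s.reg 1 = 0
  one : s.reg 2 = 1
  zero : s.reg 3 = 0
  left : s.reg 6 = a
  right : s.reg 7 = a'
  input : s.arr 0 = g

section Frame

variable {g : ℕ → ℕ} {n a a' r k i v : ℕ} {F F' : Prop} {s : Store}

theorem Frame.setReg (h : Frame g n F a a' s) (hr : r = 4 ∨ r = 5 ∨ 8 ≤ r) :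
    Frame g n F a a' (s.setReg r v) := by
  obtain ⟨h0, h1, h1', h2, h3, h6, h7, hg⟩ := h
  refine ⟨?_, ?_, ?_, ?_, ?_, ?_, ?_, hg⟩ <;> rw [Store.reg_setReg, if_neg (by omega)] <;> assumption

theorem Frame.setArr (h : Frame g n F a a' s) (hk : k ≠ 0) :
    Frame g n F a a' (s.setArr k i v) where
  length := h.length
  answer_true := h.answer_true
  answer_false := h.answer_false
  one := h.one
  zero := h.zero
  left := h.left
  right := h.right
  input := by rw [Store.arr_setArr, if_neg hk.symm]; exact h.input

theorem Frame.congr (h : Frame g n F a a' s) (hF : F ↔ F') : Frame g n F' a a' s := by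
  rwa [← propext hF]

end Frame

/-- Invariant rule for a scan: besides the body, each letter costs a test, an increment and a load.
-/
theorem Run.wordLoop {W T r a b : ℕ} {body : Program} {g : ℕ → ℕ} {Inv : ℕ → Store → Prop}
    {s : Store} (hab : a ≤ b) (hpos : ∀ p, a ≤ p → p < b → 0 < g p) (hb : g b = 0) (hbW : b ≤ W)
    (hgW : ∀ p, g p ≤ W)
    (hbase : ∀ p s, Inv p s → s.reg 2 = 1 ∧ s.reg 3 = 0 ∧ s.arr 0 = g)
    (hstable4 : ∀ p s v, Inv p s → Inv p (s.setReg 4 v))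
    (hstable5 : ∀ p s v, Inv p s → Inv p (s.setReg 5 v))
    (hbody : ∀ p s, a ≤ p → p < b → Inv p s → s.reg 4 = p → s.reg 5 = g p →
      Run W body s T fun s' => Inv (p + 1) s' ∧ s'.reg 4 = p)
    (hs : Inv a s) (hr : s.reg r = a) :
    Run W (wordLoop r body) s ((T + 3) * (b - a) + 3) fun s' => Inv b s' ∧ s'.reg 4 = b := by
  have loop : ∀ m p s, p + m = b → a ≤ p → Inv p s → s.reg 4 = p → s.reg 5 = g p →
      Run W (.loop (.lt 3 5) (.seq body (.seq (.add 4 4 2) (.load 5 0 4)))) s ((T + 3) * m + 1)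
        fun s' => Inv b s' ∧ s'.reg 4 = b := by
    intro m
    induction m with
    | zero =>
      intro p s hp hap hs h4 h5
      obtain rfl : p = b := hp
      refine (Run.loop_false ?_ ⟨hs, h4⟩).mono (by omega) fun _ => id
      simp [Test.Holds, h5, hb]
    | succ m ih =>
      intro p s hp hap hs h4 h5
      have hpb : p < b := by omega
      refine (Run.loop_true (P := fun s' => Inv (p + 1) s' ∧ s'.reg 4 = p + 1 ∧
        s'.reg 5 = g (p + 1)) (T₁ := T + 2) (T₂ := (T + 3) * m + 1) ?_ ?_ ?_).mono ?_ fun _ => id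
      · simp only [Test.Holds, h5, (hbase p s hs).2.1]
        exact hpos p hap hpb
      · refine (hbody p s hap hpb hs h4 h5).seq ?_
        rintro s' ⟨hs', h4'⟩
        obtain ⟨h2, -, h0⟩ := hbase _ _ hs'
        refine Run.instr_seq (.add _ _ _ _ (by omega)) ?_
        have h4'' : (s'.setReg 4 (s'.reg 4 + s'.reg 2)).reg 4 = p + 1 := by simp [h4', h2]
        have hg : (s'.setReg 4 (s'.reg 4 + s'.reg 2)).arr 0
            ((s'.setReg 4 (s'.reg 4 + s'.reg 2)).reg 4) = g (p + 1) := by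
          rw [h4'', Store.arr_setReg, h0]
        refine Run.instr (.load _ _ _ _ (by rw [hg]; exact hgW _)) ⟨?_, ?_, ?_⟩
        · exact hstable5 _ _ _ (hstable4 _ _ _ hs')
        · rw [Store.reg_setReg, if_neg (by norm_num), h4'']
        · rw [Store.reg_setReg, if_pos rfl, hg]
      · rintro s' ⟨h1, h2, h3⟩
        exact ih (p + 1) s' (by omega) (by omega) h1 h2 h3
      · rw [Nat.mul_succ]
        omega
  obtain ⟨-, -, h0⟩ := hbase _ _ hs
  refine Run.instr_seq (.copy _ _ _ (by omega)) ?_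
  have hg : (s.setReg 4 (s.reg r)).arr 0 ((s.setReg 4 (s.reg r)).reg 4) = g a := by
    simp [h0, hr]
  refine Run.instr_seq (.load _ _ _ _ (by rw [hg]; exact hgW _)) ?_
  refine loop (b - a) a _ (by omega) le_rfl (hstable5 _ _ _ (hstable4 _ _ _ hs)) ?_ ?_
  · simp [hr]
  · rw [Store.reg_setReg, if_pos rfl, hg]

/-! ### Treatment of a single letter -/

section Steps

variable {W n p a a' b b₀ : ℕ} {g l c c₂ c₃ : ℕ → ℕ} {F : Prop} {s : Store} {k : ℕ}

/-- The bound 12 is a generous common one for the three loop bodies, giving 15 steps per letter in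
every scan. -/
theorem run_lastOccurrenceStep (hap : b₀ ≤ p) (hpW : p + 1 ≤ W) (hF : Frame g n F a a' s)
    (h2 : s.arr 2 = c₂) (h3 : s.arr 3 = c₃) (hl : IsLastOccurrence g b₀ p (s.arr 1))
    (h4 : s.reg 4 = p) (h5 : s.reg 5 = g p) :
    Run W lastOccurrenceStep s 12 fun s' => (Frame g n F a a' s' ∧ s'.arr 2 = c₂ ∧ s'.arr 3 = c₃ ∧
      IsLastOccurrence g b₀ (p + 1) (s'.arr 1)) ∧ s'.reg 4 = p := by
  have h2' := hF.one
  refine Run.instr_seq (.add _ _ _ _ (by omega)) ?_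
  refine Run.instr (.store _ _ _ _ (by simp; omega)) ⟨⟨?_, ?_, ?_, ?_⟩, ?_⟩
  · exact (hF.setReg (by norm_num)).setArr (by norm_num)
  · simpa using h2
  · simpa using h3
  · simpa [h4, h2', h5] using hl.succ hap
  · simpa using h4

theorem run_blockCodeStep (hk : k = 2 ∨ k = 3) (hlast : IsLastOccurrence g b₀ b l) (hpb : p < b)
    (hbW : 2 * b + 2 ≤ W) (hF : Frame g n F a a' s) (hl : s.arr 1 = l) (hc : s.arr (5 - k) = c)
    (hcode : BlockCodeUpTo g b₀ b l p (s.reg 8) (s.reg 9) (s.arr k))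
    (h4 : s.reg 4 = p) (h5 : s.reg 5 = g p) :
    Run W (blockCodeStep k) s 12 fun s' => (Frame g n F a a' s' ∧ s'.arr 1 = l ∧
      s'.arr (5 - k) = c ∧ BlockCodeUpTo g b₀ b l (p + 1) (s'.reg 8) (s'.reg 9) (s'.arr k)) ∧
      s'.reg 4 = p := by
  obtain ⟨hl1, hl2⟩ := BlockCodeUpTo.last_bounds hlast hcode.le hpb
  have h2 := hF.one
  have hk1 : 1 ≠ k := by omega
  have hk0 : k ≠ 0 := by omega
  have hk5 : 5 - k ≠ k := by omega
  have hbound := hcode.bound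
  have hle := hcode.le
  refine Run.instr_seq (.load _ _ _ _ (by rw [hl, h5]; omega)) ?_
  rw [hl, h5]
  refine Run.ite (fun ht => ?_) (fun ht => ?_)
  · replace ht : s.reg 8 = p := by simpa [Test.Holds, h4] using ht
    have hnew := hcode.succ_of_closed hlast hpb ht
    refine Run.instr_seq (.add _ _ _ _ (by simp; omega)) ?_
    refine Run.instr_seq (.add _ _ _ _ (by simp; omega)) ?_
    refine Run.instr_seq (.copy _ _ _ (by simp; omega)) ?_
    refine Run.instr_seq (.add _ _ _ _ (by simp; omega)) ?_
    refine Run.ite (fun ht' => ?_) (fun ht' => ?_)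
    · replace ht' : l (g p) = p + 1 := by simpa [Test.Holds, h4, h2] using ht'
      rw [if_pos ht'] at hnew
      refine Run.instr_seq (.add _ _ _ _ (by simp; omega)) ?_
      refine Run.instr (.store _ _ _ _ (by simp; omega)) ⟨⟨?_, ?_, ?_, ?_⟩, ?_⟩
      · refine Frame.setArr ?_ hk0
        iterate 6 refine Frame.setReg ?_ (by norm_num)
        exact hF
      · simpa [hk1] using hl
      · simpa [hk5] using hc
      · simpa [h2, h5, add_assoc] using hnew
      · simpa using h4
    · replace ht' : l (g p) ≠ p + 1 := by simpa [Test.Holds, h4, h2] using ht'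
      rw [if_neg ht'] at hnew
      refine Run.instr (.store _ _ _ _ (by simp; omega)) ⟨⟨?_, ?_, ?_, ?_⟩, ?_⟩
      · refine Frame.setArr ?_ hk0
        iterate 5 refine Frame.setReg ?_ (by norm_num)
        exact hF
      · simpa [hk1] using hl
      · simpa [hk5] using hc
      · simpa [h2, h5, add_assoc] using hnew
      · simpa using h4
  · replace ht : s.reg 8 ≠ p := by simpa [Test.Holds, h4] using ht
    have hnew := hcode.succ_of_open hlast hpb (lt_of_le_of_ne hcode.le_reach ht.symm)
    refine Run.ite (fun ht' => ?_) (fun ht' => ?_)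
    · replace ht' : s.reg 8 < l (g p) := by simpa [Test.Holds] using ht'
      rw [max_eq_right ht'.le] at hnew
      refine Run.instr_seq (.copy _ _ _ (by simp; omega)) ?_
      refine Run.instr (.store _ _ _ _ (by simp; omega)) ⟨⟨?_, ?_, ?_, ?_⟩, ?_⟩
      · exact ((hF.setReg (by norm_num)).setReg (by norm_num)).setArr hk0
      · simpa [hk1] using hl
      · simpa [hk5] using hc
      · simpa [h5] using hnew
      · simpa using h4
    · replace ht' : l (g p) ≤ s.reg 8 := by simpa [Test.Holds] using ht'
      rw [max_eq_left ht'] at hnew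
      refine Run.instr (.store _ _ _ _ (by simp; omega)) ⟨⟨?_, ?_, ?_, ?_⟩, ?_⟩
      · exact (hF.setReg (by norm_num)).setArr hk0
      · simpa [hk1] using hl
      · simpa [hk5] using hc
      · simpa [h5] using hnew
      · simpa using h4

open Classical in
/-- The function `c` after clearing the entries of the letters between `a` and `b`. -/
noncomputable def clearBetween (g : ℕ → ℕ) (a b : ℕ) (c : ℕ → ℕ) (x : ℕ) : ℕ :=
  if OccursIn g a b x then 0 else c x

theorem clearBetween_self (g : ℕ → ℕ) (a : ℕ) (c : ℕ → ℕ) : clearBetween g a a c = c := by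
  funext x
  exact if_neg not_occursIn_self

theorem clearBetween_le (g : ℕ → ℕ) (a b : ℕ) (c : ℕ → ℕ) (x : ℕ) : clearBetween g a b c x ≤ c x := by
  unfold clearBetween
  split_ifs <;> omega

theorem clearBetween_succ (c : ℕ → ℕ) (h : a ≤ p) :
    clearBetween g a (p + 1) c = Function.update (clearBetween g a p c) (g p) 0 := by
  funext x
  by_cases hx : x = g p
  · subst hx
    rw [Function.update_self]
    exact if_pos ((occursIn_succ h).2 (.inr rfl))
  · rw [Function.update_of_ne hx]
    unfold clearBetween
    rw [occursIn_succ h, or_iff_left (Ne.symm hx)]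

/-- A repeated letter finds both entries cleared and reports nothing, but a difference was already
recorded at its first occurrence. -/
theorem exists_occursIn_succ_ne (c₂ c₃ : ℕ → ℕ) (h : a ≤ p) :
    (∃ x, OccursIn g a (p + 1) x ∧ c₂ x ≠ c₃ x) ↔
      (∃ x, OccursIn g a p x ∧ c₂ x ≠ c₃ x) ∨ clearBetween g a p c₂ (g p) ≠ clearBetween g a p c₃ (g p) := by
  simp only [occursIn_succ h, or_and_right, exists_or, exists_eq_left']
  by_cases hx : OccursIn g a p (g p)
  · simp only [clearBetween, if_pos hx, ne_eq, not_true, or_false, or_iff_left_iff_imp]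
    exact fun h1 => ⟨_, hx, h1⟩
  · simp only [clearBetween, if_neg hx]

theorem run_compareStep (hap : b₀ ≤ p) (hW : 1 ≤ W) (h2W : ∀ x, c₂ x ≤ W) (h3W : ∀ x, c₃ x ≤ W)
    (hF : Frame g n (F ∨ ∃ x, OccursIn g b₀ p x ∧ c₂ x ≠ c₃ x) a a' s)
    (h2 : s.arr 2 = clearBetween g b₀ p c₂) (h3 : s.arr 3 = clearBetween g b₀ p c₃)
    (h4 : s.reg 4 = p) (h5 : s.reg 5 = g p) :
    Run W compareStep s 12 fun s' =>
      (Frame g n (F ∨ ∃ x, OccursIn g b₀ (p + 1) x ∧ c₂ x ≠ c₃ x) a a' s' ∧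
      s'.arr 2 = clearBetween g b₀ (p + 1) c₂ ∧ s'.arr 3 = clearBetween g b₀ (p + 1) c₃) ∧ s'.reg 4 = p := by
  have hz := hF.zero
  refine Run.instr_seq (.load _ _ _ _ (by rw [h2]; exact (clearBetween_le ..).trans (h2W _))) ?_
  refine Run.instr_seq (.load _ _ _ _ (by
    rw [Store.arr_setReg, h3]; exact (clearBetween_le ..).trans (h3W _))) ?_
  refine Run.instr_seq (.store _ _ _ _ (by simp [hz])) ?_
  refine Run.instr_seq (.store _ _ _ _ (by simp [hz])) ?_
  rw [exists_occursIn_succ_ne _ _ hap, ← or_assoc, clearBetween_succ _ hap, clearBetween_succ _ hap]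
  have frame (s' : Store) (h : Frame g n (F ∨ ∃ x, OccursIn g b₀ p x ∧ c₂ x ≠ c₃ x) a a' s')
      (v w i j v' w' : ℕ) : Frame g n (F ∨ ∃ x, OccursIn g b₀ p x ∧ c₂ x ≠ c₃ x) a a'
        ((((s'.setReg 10 v).setReg 12 w).setArr 2 i v').setArr 3 j w') :=
    (((h.setReg (by norm_num)).setReg (by norm_num)).setArr (by norm_num)).setArr (by norm_num)
  refine Run.ite (fun ht => ?_) (fun ht => ?_)
  · replace ht : clearBetween g b₀ p c₂ (g p) = clearBetween g b₀ p c₃ (g p) := by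
      simpa [Test.Holds, h2, h3, h5] using ht
    refine Run.instr (.skip _) ⟨⟨(frame s hF _ _ _ _ _ _).congr ?_, ?_, ?_⟩, ?_⟩
    · simp [ht]
    · simp [h2, h5, hz]
    · simp [h3, h5, hz]
    · simpa using h4
  · replace ht : clearBetween g b₀ p c₂ (g p) ≠ clearBetween g b₀ p c₃ (g p) := by
      simpa [Test.Holds, h2, h3, h5] using ht
    refine Run.instr (.const _ _ _ hW) ⟨⟨?_, ?_, ?_⟩, ?_⟩
    · obtain ⟨g0, g1, g1', g2, g3, g6, g7, gg⟩ := frame s hF (s.arr 2 (s.reg 5))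
        ((s.setReg 10 (s.arr 2 (s.reg 5))).arr 3 ((s.setReg 10 (s.arr 2 (s.reg 5))).reg 5))
        (g p) (g p) 0 0
      exact ⟨by simpa using g0, fun _ => by simp, fun h => absurd (.inr ht) h,
        by simpa using g2, by simpa using g3, by simpa using g6, by simpa using g7,
        by simpa using gg⟩
    · simp [h2, h5, hz]
    · simp [h3, h5, hz]
    · simpa using h4

end Steps

end RAM

/-! ### Treatment of a word and of an identity -/

namespace RAM

section Words

variable {W n a a' b b' r k : ℕ} {g c₂ c₃ : ℕ → ℕ} {F : Prop} {s : Store}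

theorem run_blockCode (hk : k = 2 ∨ k = 3) (hab : a ≤ b)
    (hpos : ∀ p, a ≤ p → p < b → 0 < g p) (hb : g b = 0) (hbW : 2 * b + 2 ≤ W)
    (hgW : ∀ p, g p ≤ W) {p q : ℕ} (hF : Frame g n F p q s) (hr : s.reg r = a)
    (hrp : r = 6 ∧ p = a ∨ r = 7 ∧ q = a) (hz : s.arr k = fun _ => 0) :
    Run W (blockCode r k) s (30 * (b - a) + 8) fun s' => Frame g n F p q s' ∧
      s'.arr (5 - k) = s.arr (5 - k) ∧ s'.reg 4 = b ∧ IsBlockCode g a b (s'.arr k) ∧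
      ∀ x, s'.arr k x ≤ W := by
  have start (s' : Store) (h : Frame g n F p q s') : s'.reg r = a := by
    rcases hrp with ⟨rfl, rfl⟩ | ⟨rfl, rfl⟩
    · exact h.left
    · exact h.right
  have h1 := Run.wordLoop (W := W) (T := 12) (r := r) (body := lastOccurrenceStep) (g := g)
    (Inv := fun p' s' => Frame g n F p q s' ∧ s'.arr 2 = s.arr 2 ∧ s'.arr 3 = s.arr 3 ∧
      IsLastOccurrence g a p' (s'.arr 1)) (s := s) hab hpos hb (by omega) hgW
    (fun _ _ h => ⟨h.1.one, h.1.zero, h.1.input⟩)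
    (fun _ _ _ h => ⟨h.1.setReg (by norm_num), h.2⟩)
    (fun _ _ _ h => ⟨h.1.setReg (by norm_num), h.2⟩)
    (fun p' s' h1 h2 h h4 h5 =>
      run_lastOccurrenceStep h1 (by omega) h.1 h.2.1 h.2.2.1 h.2.2.2 h4 h5)
    ⟨hF, rfl, rfl, .init g a _⟩ hr
  refine (Run.seq h1 (T₂ := 15 * (b - a) + 3 + 1 + 1) ?_).mono (by omega) fun _ => id
  rintro s₁ ⟨⟨hF₁, h2, h3, hlast⟩, -⟩
  refine Run.instr_seq (.const _ _ _ (by omega)) ?_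
  refine Run.instr_seq (.copy _ _ _ ?_) ?_
  · rw [start _ (hF₁.setReg (by norm_num))]
    omega
  rw [start _ (hF₁.setReg (by norm_num))]
  have h4 := Run.wordLoop (W := W) (T := 12) (r := r) (body := blockCodeStep k) (g := g)
    (Inv := fun p' s' => Frame g n F p q s' ∧ s'.arr 1 = s₁.arr 1 ∧ s'.arr (5 - k) = s.arr (5 - k) ∧
      BlockCodeUpTo g a b (s₁.arr 1) p' (s'.reg 8) (s'.reg 9) (s'.arr k))
    (s := (s₁.setReg 9 0).setReg 8 a) hab hpos hb (by omega) hgW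
    (fun _ _ h => ⟨h.1.one, h.1.zero, h.1.input⟩)
    (fun _ _ _ h => ⟨h.1.setReg (by norm_num), by simpa using h.2⟩)
    (fun _ _ _ h => ⟨h.1.setReg (by norm_num), by simpa using h.2⟩)
    (fun p' s' h1 h2 h h4 h5 =>
      run_blockCodeStep hk hlast h2 hbW h.1 h.2.1 h.2.2.1 h.2.2.2 h4 h5)
    ⟨(hF₁.setReg (by norm_num)).setReg (by norm_num), rfl, ?_, ?_⟩
    (start _ ((hF₁.setReg (by norm_num)).setReg (by norm_num)))
  · refine h4.mono (by omega) ?_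
    rintro s₂ ⟨⟨hF₂, -, h5, h6⟩, h7⟩
    refine ⟨hF₂, h5, h7, h6.isBlockCode, fun x => (h6.code_le x).trans ?_⟩
    have := h6.bound
    omega
  · rcases hk with rfl | rfl
    · exact h3
    · exact h2
  · have h5 : s₁.arr k = fun _ => 0 := by
      rcases hk with rfl | rfl
      · rw [h2, hz]
      · rw [h3, hz]
    simpa [h5] using BlockCodeUpTo.init hab (s₁.arr 1)

theorem run_wordLoop_compareStep (hab : a ≤ b) (hpos : ∀ p, a ≤ p → p < b → 0 < g p)
    (hb : g b = 0) (hbW : b ≤ W) (hW : 1 ≤ W) (hgW : ∀ p, g p ≤ W) {p q : ℕ}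
    (hF : Frame g n F p q s) (hr : s.reg r = a) (h2 : s.arr 2 = c₂) (h3 : s.arr 3 = c₃)
    (h2W : ∀ x, c₂ x ≤ W) (h3W : ∀ x, c₃ x ≤ W) :
    Run W (wordLoop r compareStep) s (15 * (b - a) + 3) fun s' =>
      Frame g n (F ∨ ∃ x, OccursIn g a b x ∧ c₂ x ≠ c₃ x) p q s' ∧
      s'.arr 2 = clearBetween g a b c₂ ∧ s'.arr 3 = clearBetween g a b c₃ ∧ s'.reg 4 = b := by
  have h1 := Run.wordLoop (W := W) (T := 12) (r := r) (body := compareStep) (g := g)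
    (Inv := fun p' s' => Frame g n (F ∨ ∃ x, OccursIn g a p' x ∧ c₂ x ≠ c₃ x) p q s' ∧
      s'.arr 2 = clearBetween g a p' c₂ ∧ s'.arr 3 = clearBetween g a p' c₃)
    (s := s) hab hpos hb hbW hgW
    (fun _ _ h => ⟨h.1.one, h.1.zero, h.1.input⟩)
    (fun _ _ _ h => ⟨h.1.setReg (by norm_num), h.2⟩)
    (fun _ _ _ h => ⟨h.1.setReg (by norm_num), h.2⟩)
    (fun p' s' h1 h2 h h4 h5 => run_compareStep h1 hW h2W h3W h.1 h.2.1 h.2.2 h4 h5)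
    ⟨hF.congr ?_, ?_, ?_⟩ hr
  · exact h1.mono (by omega) fun s' h => ⟨h.1.1, h.1.2.1, h.1.2.2, h.2⟩
  · simp [not_occursIn_self]
  · rw [clearBetween_self, h2]
  · rw [clearBetween_self, h3]

/-- The state between the treatment of two identities. -/
structure Ready (g : ℕ → ℕ) (n : ℕ) (F : Prop) (p : ℕ) (s : Store) : Prop where
  length : s.reg 0 = n
  answer_true : F → s.reg 1 = 1
  answer_false : ¬ F → s.reg 1 = 0
  one : s.reg 2 = 1
  zero : s.reg 3 = 0
  position : s.reg 4 = p
  input : s.arr 0 = g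
  left_codes : s.arr 2 = fun _ => 0
  right_codes : s.arr 3 = fun _ => 0

theorem clearBetween_clearBetween {c : ℕ → ℕ}
    (h : ∀ x, ¬ OccursIn g a b x → ¬ OccursIn g a' b' x → c x = 0) :
    clearBetween g a' b' (clearBetween g a b c) = fun _ => 0 := by
  funext x
  unfold clearBetween
  split_ifs with h1 h2
  · rfl
  · rfl
  · exact h x h2 h1

theorem _root_.WrittenAt.pos {w : FreeSemigroup ℕ} (h : WrittenAt g a w) (p : ℕ) (hp : a ≤ p)
    (hp' : p < a + (letters w).length) : 0 < g p := by
  obtain ⟨i, rfl⟩ := Nat.exists_eq_add_of_le hp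
  rw [h.1 i (by omega)]
  omega

theorem run_processIdentity {i : Identity} {p : ℕ} (hl : WrittenAt g p i.lhs)
    (hr : WrittenAt g (p + (letters i.lhs).length + 1) i.rhs)
    (hW : 2 * (p + (letters i.lhs).length + 1 + (letters i.rhs).length + 1) + 2 ≤ W)
    (hgW : ∀ p, g p ≤ W) (hs : Ready g n F p s) :
    Run W processIdentity s (60 * ((letters i.lhs).length + (letters i.rhs).length) + 30)
      (Ready g n (F ∨ ¬ i.HoldsIn IdemPair.{u})
        (p + (letters i.lhs).length + 1 + (letters i.rhs).length + 1)) := by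
  set b := p + (letters i.lhs).length with hb
  set b' := b + 1 + (letters i.rhs).length with hb'
  unfold processIdentity
  refine Run.mono (T₁ := 30 * (b - p) + 8 + ((30 * (b' - (b + 1)) + 8 +
    (15 * (b - p) + 3 + (15 * (b' - (b + 1)) + 3 + 1))) + 1 + 1) + 1) ?_ (by omega) fun _ => id
  refine Run.instr_seq (.copy _ _ _ (by rw [hs.position]; omega)) ?_
  rw [hs.position]
  have hF : Frame g n F p (s.reg 7) (s.setReg 6 p) :=
    { length := hs.length, answer_true := hs.answer_true, answer_false := hs.answer_false,
      one := hs.one, zero := hs.zero, left := rfl, right := rfl, input := hs.input }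
  refine Run.seq (run_blockCode (.inl rfl) (by omega) hl.pos hl.2 (by omega) hgW hF hF.left
    (.inl ⟨rfl, rfl⟩) hs.left_codes) ?_
  rintro s₁ ⟨hF₁, h3, h4, hc, hcW⟩
  replace h3 : s₁.arr 3 = fun _ => 0 := h3.trans hs.right_codes
  refine Run.instr_seq (.add _ _ _ _ (by rw [h4, hF₁.one]; omega)) ?_
  rw [h4, hF₁.one]
  refine Run.instr_seq (.copy _ _ _ (by simp; omega)) ?_
  have h41 : (s₁.setReg 4 (b + 1)).reg 4 = b + 1 := by simp
  rw [h41]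
  have hF₂ : Frame g n F p (b + 1) ((s₁.setReg 4 (b + 1)).setReg 7 (b + 1)) :=
    { length := hF₁.length, answer_true := hF₁.answer_true, answer_false := hF₁.answer_false,
      one := hF₁.one, zero := hF₁.zero, left := hF₁.left, right := rfl, input := hF₁.input }
  refine Run.seq (run_blockCode (.inr rfl) (by omega) hr.pos hr.2 (by omega) hgW hF₂ hF₂.right
    (.inr ⟨rfl, rfl⟩) h3) ?_
  rintro s₃ ⟨hF₃, h2, -, hc', hcW'⟩
  replace h2 : s₃.arr 2 = s₁.arr 2 := h2
  rw [← h2] at hc hcW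
  refine Run.seq (run_wordLoop_compareStep (by omega) hl.pos hl.2 (by omega) (by omega) hgW hF₃
    hF₃.left rfl rfl hcW hcW') ?_
  rintro s₄ ⟨hF₄, h5, h6, -⟩
  refine Run.seq (run_wordLoop_compareStep (by omega) hr.pos hr.2 (by omega) (by omega) hgW hF₄
    hF₄.right h5 h6 (fun x => (clearBetween_le ..).trans (hcW x))
    (fun x => (clearBetween_le ..).trans (hcW' x))) ?_
  rintro s₅ ⟨hF₅, h7, h8, h9⟩
  refine Run.instr (T := 0) (.add _ _ _ _ (by rw [h9, hF₅.one]; omega)) ?_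
  rw [h9, hF₅.one]
  -- Both codes vanish off the two words, so any difference sits at a letter of one of them; letters
  -- only on the right keep their entries through the first pass.
  have answer : ((F ∨ ∃ x, OccursIn g p b x ∧ s₃.arr 2 x ≠ s₃.arr 3 x) ∨
      ∃ x, OccursIn g (b + 1) b' x ∧ clearBetween g p b (s₃.arr 2) x ≠
        clearBetween g p b (s₃.arr 3) x) ↔ (F ∨ ¬ i.HoldsIn IdemPair.{u}) := by
    rw [IdemPair.holdsIn_iff hl hr hc hc', or_assoc]
    refine or_congr Iff.rfl ⟨?_, fun hne => ?_⟩
    · rintro (⟨x, -, hx⟩ | ⟨x, -, hx⟩) heq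
      · exact hx (congrFun heq x)
      · exact hx (by rw [heq])
    · obtain ⟨x, hx⟩ := Function.ne_iff.1 hne
      by_cases h1 : OccursIn g p b x
      · exact .inl ⟨x, h1, hx⟩
      · refine .inr ⟨x, ?_, by simpa only [clearBetween, if_neg h1] using hx⟩
        by_contra h2
        exact hx ((hc.eq_zero x h1).trans (hc'.eq_zero x h2).symm)
  have hF₆ := hF₅.congr answer
  exact
    { length := hF₆.length, answer_true := hF₆.answer_true, answer_false := hF₆.answer_false,
      one := hF₆.one, zero := hF₆.zero, position := rfl, input := hF₆.input,
      left_codes := h7.trans (clearBetween_clearBetween fun x h _ => hc.eq_zero x h),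
      right_codes := h8.trans (clearBetween_clearBetween fun x _ h => hc'.eq_zero x h) }

end Words

end RAM

/-! ### The encoding of the input -/

theorem length_encodeWord (w : FreeSemigroup ℕ) :
    (encodeWord w).length = (letters w).length + 1 := by
  simp [encodeWord]

theorem encodeIdentities_cons (i : Identity) (E : List Identity) :
    encodeIdentities (i :: E) = encodeWord i.lhs ++ (encodeWord i.rhs ++ encodeIdentities E) := by
  simp [encodeIdentities]

theorem totalLength_cons (i : Identity) (E : List Identity) :
    totalLength (i :: E) =
      (letters i.lhs).length + (letters i.rhs).length + totalLength E := rfl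

theorem length_letters_pos (w : FreeSemigroup ℕ) : 0 < (letters w).length :=
  Nat.succ_pos _

/-- Words are nonempty, so there are at most as many separators as letters. -/
theorem length_encodeIdentities_le (E : List Identity) :
    (encodeIdentities E).length ≤ 2 * totalLength E := by
  induction E with
  | nil => exact Nat.zero_le _
  | cons i E ih =>
    have h1 := length_letters_pos i.lhs
    have h2 := length_letters_pos i.rhs
    simp only [encodeIdentities_cons, List.length_append, length_encodeWord, totalLength_cons]
    omega

theorem writtenAt_of_getD_encodeWord {g : ℕ → ℕ} {p : ℕ} {w : FreeSemigroup ℕ} {l : List ℕ}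
    (h : ∀ j, g (p + j) = (encodeWord w ++ l).getD j 0) :
    WrittenAt g p w ∧ ∀ j, g (p + (letters w).length + 1 + j) = l.getD j 0 := by
  refine ⟨⟨fun j hj => ?_, ?_⟩, fun j => ?_⟩
  · rw [h, List.getD_append _ _ _ _ (by rw [length_encodeWord]; omega), encodeWord,
      List.getD_append _ _ _ _ (by simpa using hj), List.getD_eq_getElem _ _ (by simpa using hj)]
    simp
  · rw [h, List.getD_append _ _ _ _ (by rw [length_encodeWord]; omega), encodeWord,
      List.getD_append_right _ _ _ _ (by simp)]
    simp
  · rw [add_assoc, add_assoc, h, List.getD_append_right _ _ _ _ (by rw [length_encodeWord]; omega),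
      length_encodeWord]
    congr 1
    omega

theorem le_foldr_max {x : ℕ} {l : List ℕ} (h : x ∈ l) : x ≤ l.foldr max 0 := by
  induction l with
  | nil => cases h
  | cons y l ih =>
    rcases List.mem_cons.1 h with rfl | h
    · exact le_max_left _ _
    · exact (ih h).trans (le_max_right _ _)

theorem encodeIdentities_le (E : List Identity) {x : ℕ} (hx : x ∈ encodeIdentities E) :
    x ≤ maxLetter E + 1 := by
  obtain ⟨i, hi, hx⟩ := List.mem_flatMap.1 hx
  have key : ∀ w : FreeSemigroup ℕ, (∀ y ∈ letters w, y ∈ letters i.lhs ++ letters i.rhs) →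
      x ∈ encodeWord w → x ≤ maxLetter E + 1 := by
    intro w hw hx
    rcases List.mem_append.1 hx with hx | hx
    · obtain ⟨y, hy, rfl⟩ := List.mem_map.1 hx
      exact Nat.succ_le_succ (le_foldr_max (List.mem_flatMap.2 ⟨i, hi, hw y hy⟩))
    · rw [List.mem_singleton.1 hx]
      exact Nat.zero_le _
  rcases List.mem_append.1 hx with hx | hx
  · exact key _ (fun y hy => List.mem_append_left _ hy) hx
  · exact key _ (fun y hy => List.mem_append_right _ hy) hx

/-! ### The main loop -/

namespace RAM

/-- F stands for "an earlier identity fails". An identity has L ≥ 2 letters, so its constant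
overhead is absorbed: 60L + 31 ≤ 80L. -/
theorem run_mainLoop {W n : ℕ} {g : ℕ → ℕ} (hW : 2 * n + 2 ≤ W) (hgW : ∀ p, g p ≤ W)
    (E : List Identity) (F : Prop) (p : ℕ) (s : Store) (hp : p + (encodeIdentities E).length = n)
    (hg : ∀ j, g (p + j) = (encodeIdentities E).getD j 0) (hs : Ready g n F p s) :
    Run W (.loop (.lt 4 0) processIdentity) s (80 * totalLength E + 1)
      (Ready g n (F ∨ ∃ i ∈ E, ¬ i.HoldsIn IdemPair.{u}) n) := by
  induction E generalizing F p s with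
  | nil =>
    obtain rfl : p = n := by simpa [encodeIdentities] using hp
    refine (Run.loop_false ?_ (by simpa using hs)).mono (by omega) fun _ => id
    simp [Test.Holds, hs.length, hs.position]
  | cons i E ih =>
    rw [encodeIdentities_cons] at hg hp
    simp only [List.length_append, length_encodeWord] at hp
    obtain ⟨hl, hg'⟩ := writtenAt_of_getD_encodeWord hg
    obtain ⟨hr, hg''⟩ := writtenAt_of_getD_encodeWord hg'
    have h1 := length_letters_pos i.lhs
    have h2 := length_letters_pos i.rhs
    refine (Run.loop_true ?_ (run_processIdentity.{u} hl hr (by omega) hgW hs)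
      (fun s' hs' => ih _ _ s' (by omega) hg'' hs')).mono ?_ ?_
    · simp only [Test.Holds, hs.length, hs.position]
      omega
    · rw [totalLength_cons]
      omega
    · intro s'
      simp only [List.exists_mem_cons_iff, or_assoc, imp_self]

theorem run_decisionProgram {W : ℕ} (E : List Identity)
    (hW : 4 * totalLength E + maxLetter E + 2 ≤ W) :
    Run W decisionProgram (initStore (encodeIdentities E)) (80 * totalLength E + 3) fun s =>
      ((∃ i ∈ E, ¬ i.HoldsIn IdemPair.{u}) → s.reg 0 = 1) ∧
      (¬ (∃ i ∈ E, ¬ i.HoldsIn IdemPair.{u}) → s.reg 0 = 0) := by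
  have hlen := length_encodeIdentities_le E
  have hgW (p : ℕ) : (encodeIdentities E).getD p 0 ≤ W := by
    by_cases hp : p < (encodeIdentities E).length
    · rw [List.getD_eq_getElem _ _ hp]
      exact (encodeIdentities_le E (List.getElem_mem hp)).trans (by omega)
    · rw [List.getD_eq_default _ _ (by omega)]
      omega
  refine Run.mono (T₁ := (80 * totalLength E + 1) + 1 + 1) ?_ (by omega) fun _ => id
  refine Run.instr_seq (.const _ _ _ (by omega)) ?_
  refine Run.seq (T₂ := 1) (run_mainLoop.{u} (n := (encodeIdentities E).length) (by omega) hgW E False 0 _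
    (by omega) (by simp) ?_) ?_
  · exact
      { length := rfl, answer_true := False.elim, answer_false := fun _ => rfl, one := rfl,
        zero := rfl, position := rfl, input := rfl, left_codes := rfl, right_codes := rfl }
  · intro s hs
    rw [false_or] at hs
    have h1 : s.reg 1 ≤ W := by
      by_cases h : ∃ i ∈ E, ¬ i.HoldsIn IdemPair.{u}
      · rw [hs.answer_true h]
        omega
      · rw [hs.answer_false h]
        omega
    exact Run.instr (T := 0) (.copy _ _ _ h1) ⟨hs.answer_true, hs.answer_false⟩

end RAM

theorem corollary4 :
    DecidableInLinearTime (fun E : List Identity => VarietyRegularlyClosed.{u} E) := by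
  refine ⟨RAM.decisionProgram, 80, fun E => ?_⟩
  obtain ⟨t, s, ht, hrun, h1, h0⟩ := RAM.run_decisionProgram.{u}
    (W := 80 * (totalLength E + maxLetter E + 1)) E (by omega)
  rw [← varietyRegularlyClosed_iff] at h1 h0
  exact ⟨t, s, hrun, by omega, h1, h0⟩
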